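/- Let $\Bbbk$ be $\mathbb{R}$ or $\mathbb{C}$, let $Q=(Q_0,Q_1,s,t)$ be a quiver with a finite non-empty set of vertices, with paths composed from left to right ($\alpha\beta$ is a path if $t(\alpha)=s(\beta)$), and let $I$ be a two-sided ideal of the path algebra $\Bbbk Q$ such that $A=\Bbbk Q/I$ is finite-dimensional. Assume that $A$ is gentle, that is: (1) at most two arrows start and at most two arrows end at each vertex; (2) if $\alpha_1\ne\alpha_2$ and $\beta$ are arrows with $t(\alpha_1)=t(\alpha_2)=s(\beta)$, then exactly one of $\alpha_1\beta,\alpha_2\beta$ lies in $I$; (3) if $\alpha$ and $\beta_1\neq\beta_2$ are arrows with $t(\alpha)=s(\beta_1)=s(\beta_2)$, then exactly one of $\alpha\beta_1,\alpha\beta_2$ lies in $I$; (4) $I$ is generated by paths of length two. Assume that $\operatorname{gl.dim}A<+\infty$. Let $A^!=\Bbbk Q^!/I^!$ be the Koszul dual of $A$: $Q^!$ is $Q$ with all arrows reversed ($\alpha$ becomes $\alpha^!$), and $I^!=\langle \alpha^!\beta^! \mid \beta\alpha \text{ is a path of } Q,\ \beta\alpha\notin I\rangle$. A permitted thread of $A^!$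 is a path $P=a_1\cdots a_l$ in $Q^!$ such that $a_ia_{i+1}\notin I^!$ for $1\le i\le l-1$, $a_l\alpha\in I^!$ for every arrow $\alpha$ of $Q^!$ with $s(\alpha)=t(a_l)$, and $\alpha a_1\in I^!$ for every arrow $\alpha$ of $Q^!$ with $t(\alpha)=s(a_1)$; a trivial path ($l=0$) is a permitted thread if no arrow starts or ends at its vertex. Let $\mathrm{perm}(A^!)$ be the set of permitted threads of $A^!$ and $\ell(P)$ the length of $P$. For $P\in\mathrm{perm}(A^!)$ let $\mathsf{w}_P:A^!\to\Bbbk$ be the (well-defined) linear map $\sum_p k_p\,p+I^!\mapsto k_P$, and regard its restriction $\mathsf{w}_P|_{\Bbbk P}$ as a function on $\Bbbk$ through $\Bbbk\cong\Bbbk P$, $x\mapsto xP$; in particular it is defined on $[1,2]\subset\mathbb{R}\subseteq\Bbbk$. Then there is a family of Lebesgue–Stieltjes measures $(\varphi_l)_{l\in\{\ell(P)\mid P\in\mathrm{perm}(A^!)\}}$ on $[1,2]$, where $\varphi_l$ is the measure on $[1,2]$ of a non-decreasing right-continuous function that equals $\ln t^l$ for $t\in[1,2]$, and $$\varphi_l([1,t])=\ln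 t^l\qquad (1\le t\le 2),$$ such that every $\mathsf{w}_P|_{\Bbbk P}$ is $\varphi_{\ell(P)}$-integrable over $[1,2]$ with a real integral, and $$\operatorname{gl.dim}A=\sup_{P\in\mathrm{perm}(A^!)}\ (\mathrm{L\text{-}S})\int_1^2 \mathsf{w}_P|_{\Bbbk P}\,\mathrm{d}\varphi_{\ell(P)} .$$ -/

import Mathlib

open CategoryTheory MeasureTheory

universe u w z

noncomputable section

/-! ### Paths of a quiver and the path algebra -/

/-- A path of the quiver `V` (of any length `≥ 0`), bundled with its source and target.
A Mathlib path `a₁ a₂ ⋯ a_l` satisfies `t(a_i) = s(a_{i+1})`: it is read from left to right. -/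
@[ext]
structure QPath (V : Type u) [Quiver.{w} V] where
  source : V
  target : V
  path : Quiver.Path source target

namespace QPath

variable {V : Type u} [Quiver.{w} V]

/-- The length of a path. -/
def length (p : QPath V) : ℕ := p.path.length

/-- The trivial path `e_v` at the vertex `v`. -/
def trivial (v : V) : QPath V := ⟨v, v, Quiver.Path.nil⟩

/-- The concatenation `pq` of two paths with `t(p) = s(q)`. -/
def comp (p q : QPath V) (h : p.target = q.source) : QPath V :=
  ⟨p.source, q.target, p.path.comp (q.path.cast h.symm rfl)⟩

/-- The path `αβ` of length two, for arrows with `t(α) = s(β)`. -/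
def two {a b c : V} (α : a ⟶ b) (β : b ⟶ c) : QPath V :=
  ⟨a, c, (Quiver.Path.nil.cons α).cons β⟩

theorem comp_assoc (p q r : QPath V) (h : p.target = q.source) (h' : q.target = r.source) :
    (p.comp q h).comp r h' = p.comp (q.comp r h') h := by
  obtain ⟨a, b, p⟩ := p
  obtain ⟨c, d, q⟩ := q
  obtain ⟨e, f, r⟩ := r
  dsimp only at h h'
  subst h h'
  simp [comp]

end QPath

/-- The path algebra `𝕜Q`: formal linear combinations of paths. -/
def PathAlgebra (𝕜 : Type z) [Field 𝕜] (V : Type u) [Quiver.{w} V] : Type (max u w z) :=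
  QPath V →₀ 𝕜

namespace PathAlgebra

variable {𝕜 : Type z} [Field 𝕜] {V : Type u} [Quiver.{w} V]

instance : AddCommGroup (PathAlgebra 𝕜 V) := inferInstanceAs (AddCommGroup (QPath V →₀ 𝕜))

instance : Module 𝕜 (PathAlgebra 𝕜 V) := inferInstanceAs (Module 𝕜 (QPath V →₀ 𝕜))

/-- A path as an element of the path algebra. -/
def of (p : QPath V) : PathAlgebra 𝕜 V := Finsupp.single p (1 : 𝕜)

/-- The coefficient `k_p` of the path `p` in `∑ k_p p`. -/
def coeff (p : QPath V) : PathAlgebra 𝕜 V →ₗ[𝕜] 𝕜 := Finsupp.lapply p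

open Classical in
/-- The product of two paths: `pq` if `t(p) = s(q)`, and `0` otherwise. -/
def mulPath (p q : QPath V) : PathAlgebra 𝕜 V :=
  if h : p.target = q.source then of (p.comp q h) else 0

/-- The bilinear extension of the product of paths. -/
def mulLin : PathAlgebra 𝕜 V →ₗ[𝕜] PathAlgebra 𝕜 V →ₗ[𝕜] PathAlgebra 𝕜 V :=
  Finsupp.linearCombination 𝕜 fun p : QPath V =>
    (Finsupp.linearCombination 𝕜 fun q : QPath V => (mulPath p q : PathAlgebra 𝕜 V) :
      (QPath V →₀ 𝕜) →ₗ[𝕜] PathAlgebra 𝕜 V)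

instance : Mul (PathAlgebra 𝕜 V) := ⟨fun x y => mulLin x y⟩

/-- The unit `∑ e_v` of the path algebra of a quiver with finitely many vertices. -/
instance [Finite V] : One (PathAlgebra 𝕜 V) :=
  ⟨letI := Fintype.ofFinite V; ∑ v : V, of (QPath.trivial v)⟩

theorem mul_def (x y : PathAlgebra 𝕜 V) : x * y = mulLin x y := rfl

theorem one_def [Fintype V] : (1 : PathAlgebra 𝕜 V) = ∑ v : V, of (QPath.trivial v) := by
  change (letI := Fintype.ofFinite V; ∑ v : V, of (QPath.trivial v)) = _
  congr!

theorem mulLin_of_of (p q : QPath V) :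
    mulLin (of p : PathAlgebra 𝕜 V) (of q) = mulPath p q := by
  simp only [mulLin, of]
  erw [Finsupp.linearCombination_single, one_smul, Finsupp.linearCombination_single, one_smul]

theorem coeff_of_self (p : QPath V) : coeff p (of p : PathAlgebra 𝕜 V) = 1 :=
  Finsupp.single_eq_same

theorem coeff_of_ne {p q : QPath V} (h : q ≠ p) : coeff p (of q : PathAlgebra 𝕜 V) = 0 :=
  Finsupp.single_eq_of_ne h.symm

/-- An additive property of elements holds if it holds for all multiples of paths. -/
theorem induction {motive : PathAlgebra 𝕜 V → Prop} (x : PathAlgebra 𝕜 V)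
    (zero : motive 0) (add : ∀ x y, motive x → motive y → motive (x + y))
    (smul_of : ∀ (c : 𝕜) p, motive (c • of p)) : motive x := by
  refine Finsupp.induction_linear (motive := motive) x zero add fun p c => ?_
  have h : (c • of p : PathAlgebra 𝕜 V) = (Finsupp.single p c : QPath V →₀ 𝕜) := by
    change (c • Finsupp.single p (1 : 𝕜) : QPath V →₀ 𝕜) = _
    rw [Finsupp.smul_single, smul_eq_mul, mul_one]
  exact h ▸ smul_of c p

theorem mulPath_eq_of {p q : QPath V} (h : p.target = q.source) :
    (mulPath p q : PathAlgebra 𝕜 V) = of (p.comp q h) := dif_pos h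

theorem mulPath_eq_zero {p q : QPath V} (h : p.target ≠ q.source) :
    (mulPath p q : PathAlgebra 𝕜 V) = 0 := dif_neg h

theorem mulLin_mulPath (p q r : QPath V) :
    mulLin (mulPath p q : PathAlgebra 𝕜 V) (of r) = mulLin (of p) (mulPath q r) := by
  by_cases h : p.target = q.source <;> by_cases h' : q.target = r.source
  · rw [mulPath_eq_of h, mulPath_eq_of h', mulLin_of_of, mulLin_of_of,
      mulPath_eq_of (p := p.comp q h) h', mulPath_eq_of (q := q.comp r h') h, QPath.comp_assoc]
  · rw [mulPath_eq_of h, mulPath_eq_zero h', mulLin_of_of,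
      mulPath_eq_zero (p := p.comp q h) h', map_zero]
  · rw [mulPath_eq_zero h, mulPath_eq_of h', mulLin_of_of,
      mulPath_eq_zero (q := q.comp r h') h, map_zero, LinearMap.zero_apply]
  · rw [mulPath_eq_zero h, mulPath_eq_zero h', map_zero, map_zero, LinearMap.zero_apply]

theorem mulLin_assoc (x y t : PathAlgebra 𝕜 V) :
    mulLin (mulLin x y) t = mulLin x (mulLin y t) := by
  induction x using induction with
  | zero => simp
  | add x x' hx hx' => simp [hx, hx']
  | smul_of c p =>
    induction y using induction with
    | zero => simp
    | add y y' hy hy' => simp only [map_add, LinearMap.add_apply, hy, hy']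
    | smul_of c' q =>
      induction t using induction with
      | zero => simp
      | add t t' ht ht' => simp only [map_add, ht, ht']
      | smul_of c'' r =>
        simp only [map_smul, LinearMap.smul_apply, mulLin_of_of, mulLin_mulPath]

theorem mulPath_trivial_left [DecidableEq V] (v : V) (p : QPath V) :
    (mulPath (QPath.trivial v) p : PathAlgebra 𝕜 V) = if v = p.source then of p else 0 := by
  split_ifs with h
  · subst h
    rw [mulPath_eq_of (p := QPath.trivial p.source) rfl]
    simp [QPath.comp, QPath.trivial]
  · exact mulPath_eq_zero (p := QPath.trivial v) h

theorem mulPath_trivial_right [DecidableEq V] (v : V) (p : QPath V) :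
    (mulPath p (QPath.trivial v) : PathAlgebra 𝕜 V) = if p.target = v then of p else 0 := by
  split_ifs with h
  · subst h
    rw [mulPath_eq_of (q := QPath.trivial p.target) rfl]
    simp [QPath.comp, QPath.trivial]
  · exact mulPath_eq_zero (q := QPath.trivial v) h

theorem mulLin_one_left [Finite V] (x : PathAlgebra 𝕜 V) : mulLin 1 x = x := by
  classical
  let _ := Fintype.ofFinite V
  rw [one_def]
  induction x using induction with
  | zero => simp
  | add x y hx hy => rw [map_add, hx, hy]
  | smul_of c p => simp [mulLin_of_of, mulPath_trivial_left]

theorem mulLin_one_right [Finite V] (x : PathAlgebra 𝕜 V) : mulLin x 1 = x := by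
  classical
  let _ := Fintype.ofFinite V
  rw [one_def]
  induction x using induction with
  | zero => simp
  | add x y hx hy => rw [map_add, LinearMap.add_apply, hx, hy]
  | smul_of c p => simp [mulLin_of_of, mulPath_trivial_right]

instance [Finite V] : Ring (PathAlgebra 𝕜 V) where
  __ := (inferInstance : AddCommGroup (PathAlgebra 𝕜 V))
  mul := (· * ·)
  one := 1
  left_distrib x y t := by simp only [mul_def, map_add]
  right_distrib x y t := by simp only [mul_def, map_add, LinearMap.add_apply]
  zero_mul x := by simp only [mul_def, map_zero, LinearMap.zero_apply]
  mul_zero x := by simp only [mul_def, map_zero]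
  mul_assoc := mulLin_assoc
  one_mul := mulLin_one_left
  mul_one := mulLin_one_right

instance [Finite V] : Algebra 𝕜 (PathAlgebra 𝕜 V) :=
  Algebra.ofModule (fun c x y => by simp only [mul_def, map_smul, LinearMap.smul_apply])
    (fun c x y => by simp only [mul_def, map_smul])

end PathAlgebra

/-! ### Bound quivers, gentle pairs and the quadratic dual -/

instance Opposite.instFinite {V : Type u} [Finite V] : Finite Vᵒᵖ :=
  Finite.of_equiv V Opposite.equivToOpposite

section BoundQuiver

variable {𝕜 : Type z} [Field 𝕜] {V : Type u} [Quiver.{w} V] [Finite V]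

open PathAlgebra

/-- The algebra `𝕜Q/I` of the bound quiver `(Q, I)`. -/
abbrev BoundQuiverAlgebra (I : TwoSidedIdeal (PathAlgebra 𝕜 V)) : Type (max u w z) :=
  I.ringCon.Quotient

/-- The path `αβ` of length two as an element of the path algebra. -/
def twoPath {a b c : V} (α : a ⟶ b) (β : b ⟶ c) : PathAlgebra 𝕜 V := of (QPath.two α β)

/-- `(Q, I)` is a gentle pair. -/
structure IsGentlePair (I : TwoSidedIdeal (PathAlgebra 𝕜 V)) : Prop where
  /-- At most two arrows start at each vertex. -/
  card_out_le : ∀ v : V, ENat.card (Σ b : V, (v ⟶ b)) ≤ 2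
  /-- At most two arrows end at each vertex. -/
  card_in_le : ∀ v : V, ENat.card (Σ a : V, (a ⟶ v)) ≤ 2
  /-- If `α₁ ≠ α₂` end where `β` starts, exactly one of `α₁β`, `α₂β` lies in `I`. -/
  xor_left : ∀ {a₁ a₂ b c : V} (α₁ : a₁ ⟶ b) (α₂ : a₂ ⟶ b) (β : b ⟶ c),
    (⟨a₁, α₁⟩ : Σ a : V, (a ⟶ b)) ≠ ⟨a₂, α₂⟩ → Xor (twoPath α₁ β ∈ I) (twoPath α₂ β ∈ I)
  /-- If `β₁ ≠ β₂` start where `α` ends, exactly one of `αβ₁`, `αβ₂` lies in `I`. -/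
  xor_right : ∀ {a b c₁ c₂ : V} (α : a ⟶ b) (β₁ : b ⟶ c₁) (β₂ : b ⟶ c₂),
    (⟨c₁, β₁⟩ : Σ c : V, (b ⟶ c)) ≠ ⟨c₂, β₂⟩ → Xor (twoPath α β₁ ∈ I) (twoPath α β₂ ∈ I)
  /-- `I` is generated by paths of length two. -/
  generated : ∃ S : Set (QPath V), (∀ p ∈ S, p.length = 2) ∧ I = TwoSidedIdeal.span (of '' S)

/-- The ideal `I^! = ⟨α^! β^! | βα ∉ I⟩` of the path algebra of the quiver `Q^!`, which is `Q` with
all arrows reversed; here `β : a ⟶ b` and `α : b ⟶ c` are arrows of `Q`. -/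
def koszulDualIdeal (I : TwoSidedIdeal (PathAlgebra 𝕜 V)) : TwoSidedIdeal (PathAlgebra 𝕜 Vᵒᵖ) :=
  TwoSidedIdeal.span {x | ∃ (a b c : V) (β : a ⟶ b) (α : b ⟶ c),
    (twoPath β α : PathAlgebra 𝕜 V) ∉ I ∧ x = twoPath α.op β.op}

/-- The Koszul dual `A^! = 𝕜Q^!/I^!` of the quadratic monomial algebra `A = 𝕜Q/I`. -/
abbrev KoszulDual (I : TwoSidedIdeal (PathAlgebra 𝕜 V)) : Type (max u w z) :=
  BoundQuiverAlgebra (koszulDualIdeal I)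

/-- `P = a₁ ⋯ a_l` is a permitted thread of `(Q, I)`: no `a_i a_{i+1}` lies in `I`, and `P` is
maximal with this property, i.e. `a_l α ∈ I` for every arrow `α` starting at `t(P)`, and
`α a₁ ∈ I` for every arrow `α` ending at `s(P)`.  For `l = 0` maximality means that no arrow starts
or ends at the vertex. -/
structure IsPermittedThread (I : TwoSidedIdeal (PathAlgebra 𝕜 V)) (P : QPath V) : Prop where
  consecutive : ∀ {a b c d e : V} (p : Quiver.Path a b) (α : b ⟶ c) (β : c ⟶ d)
    (q : Quiver.Path d e), P = ⟨a, e, ((p.cons α).cons β).comp q⟩ → twoPath α β ∉ I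
  maximal_right : ∀ {a b c d : V} (p : Quiver.Path a b) (β : b ⟶ c) (α : c ⟶ d),
    P = ⟨a, c, p.cons β⟩ → twoPath β α ∈ I
  maximal_left : ∀ {a b c d : V} (α : a ⟶ b) (β : b ⟶ c) (q : Quiver.Path c d),
    P = ⟨b, d, β.toPath.comp q⟩ → twoPath α β ∈ I
  isolated : ∀ v : V, P = QPath.trivial v → ∀ b : V, IsEmpty (v ⟶ b) ∧ IsEmpty (b ⟶ v)

/-- If an ideal is generated by paths of length two, the coefficient of a path none of whose
subpaths of length two lies in the ideal vanishes on the ideal. -/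
theorem coeff_eq_zero_of_mem_span {T : Set (PathAlgebra 𝕜 V)}
    (hT : ∀ x ∈ T, ∃ (a b c : V) (α : a ⟶ b) (β : b ⟶ c), x = twoPath α β) {P : QPath V}
    (hP : IsPermittedThread (TwoSidedIdeal.span T) P) {x : PathAlgebra 𝕜 V}
    (hx : x ∈ TwoSidedIdeal.span T) : coeff P x = 0 := by
  rw [TwoSidedIdeal.mem_span_iff_mem_addSubgroup_closure] at hx
  induction hx using AddSubgroup.closure_induction with
  | zero => simp
  | add x y _ _ hx hy => rw [map_add, hx, hy, add_zero]
  | neg x _ hx => rw [map_neg, hx, neg_zero]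
  | mem x hx =>
    obtain ⟨_, ⟨y, -, t, ht, rfl⟩, y', -, rfl⟩ := hx
    obtain ⟨a, b, c, α, β, rfl⟩ := hT t ht
    have hI := TwoSidedIdeal.subset_span (s := T) ht
    induction y using induction with
    | zero => simp
    | add y z hy hz => simp only [add_mul, map_add] at hy hz ⊢; rw [hy, hz, add_zero]
    | smul_of k p =>
      induction y' using induction with
      | zero => simp
      | add y z hy hz => simp only [mul_add, map_add] at hy hz ⊢; rw [hy, hz, add_zero]
      | smul_of k' q =>
        simp only [Algebra.smul_mul_assoc, Algebra.mul_smul_comm, map_smul]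
        suffices h : coeff P (of p * twoPath α β * of q : PathAlgebra 𝕜 V) = 0 by simp [h]
        simp only [mul_def, twoPath, mulLin_of_of]
        by_cases hp : p.target = a
        · by_cases hq : c = q.source
          · rw [mulPath_eq_of (q := QPath.two α β) hp, mulLin_of_of,
              mulPath_eq_of (p := p.comp (QPath.two α β) hp) hq]
            refine coeff_of_ne fun hPe => ?_
            obtain ⟨p₁, p₂, p⟩ := p
            obtain ⟨q₁, q₂, q⟩ := q
            dsimp only at hp hq
            subst hp hq
            exact hP.consecutive p α β q (by rw [← hPe]; simp [QPath.comp, QPath.two]) hI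
          · rw [mulPath_eq_of (q := QPath.two α β) hp, mulLin_of_of,
              mulPath_eq_zero (p := p.comp (QPath.two α β) hp) hq, map_zero]
        · rw [mulPath_eq_zero (q := QPath.two α β) hp, map_zero, LinearMap.zero_apply, map_zero]

/-- The class in `A^!` of a path of `Q^!`. -/
def KoszulDual.of (I : TwoSidedIdeal (PathAlgebra 𝕜 V)) (P : QPath Vᵒᵖ) : KoszulDual I :=
  (koszulDualIdeal I).ringCon.mk' (PathAlgebra.of P)

/-- The linear functional `w_P : A^! → 𝕜`, `∑ k_p p + I^! ↦ k_P`, for a permitted thread `P` of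
`A^!`. -/
def threadFunctional {I : TwoSidedIdeal (PathAlgebra 𝕜 V)} {P : QPath Vᵒᵖ}
    (hP : IsPermittedThread (koszulDualIdeal I) P) : KoszulDual I →ₗ[𝕜] 𝕜 where
  toFun := Quotient.lift (s := (koszulDualIdeal I).ringCon.toSetoid) (coeff P) fun x y hxy => by
    rw [← sub_eq_zero, ← map_sub]
    refine coeff_eq_zero_of_mem_span ?_ hP (((koszulDualIdeal I).rel_iff x y).1 hxy)
    rintro _ ⟨a, b, c, β, α, -, rfl⟩
    exact ⟨_, _, _, _, _, rfl⟩
  map_add' := by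
    rintro ⟨x⟩ ⟨y⟩
    exact map_add (coeff P) x y
  map_smul' := by
    rintro c ⟨x⟩
    exact map_smul (coeff P) c x

theorem threadFunctional_mk {I : TwoSidedIdeal (PathAlgebra 𝕜 V)} {P : QPath Vᵒᵖ}
    (hP : IsPermittedThread (koszulDualIdeal I) P) (x : PathAlgebra 𝕜 Vᵒᵖ) :
    threadFunctional hP ((koszulDualIdeal I).ringCon.mk' x) = coeff P x := rfl

/-- The restriction `w_P|_{𝕜P}` as a function of one scalar, through the identification
`𝕜 ≅ 𝕜P`, `x ↦ xP`. -/
def threadFunctionalOnLine {I : TwoSidedIdeal (PathAlgebra 𝕜 V)} {P : QPath Vᵒᵖ}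
    (hP : IsPermittedThread (koszulDualIdeal I) P) (x : 𝕜) : 𝕜 :=
  threadFunctional hP (x • KoszulDual.of I P)

theorem threadFunctionalOnLine_apply {I : TwoSidedIdeal (PathAlgebra 𝕜 V)} {P : QPath Vᵒᵖ}
    (hP : IsPermittedThread (koszulDualIdeal I) P) (x : 𝕜) :
    threadFunctionalOnLine hP x = x := by
  rw [threadFunctionalOnLine, map_smul, KoszulDual.of, threadFunctional_mk, coeff_of_self,
    smul_eq_mul, mul_one]

/-- The set `perm(A^!)` of permitted threads of `A^!`. -/
abbrev DualPermittedThread (I : TwoSidedIdeal (PathAlgebra 𝕜 V)) :=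
  {P : QPath Vᵒᵖ // IsPermittedThread (koszulDualIdeal I) P}

/-- The set `{ℓ(P) | P ∈ perm(A^!)}`. -/
def dualThreadLengths (I : TwoSidedIdeal (PathAlgebra 𝕜 V)) : Set ℕ :=
  Set.range fun P : DualPermittedThread I => P.1.length

/-- The length of a permitted thread of `A^!`, as an element of `{ℓ(P) | P ∈ perm(A^!)}`. -/
def DualPermittedThread.length {I : TwoSidedIdeal (PathAlgebra 𝕜 V)}
    (P : DualPermittedThread I) : dualThreadLengths I := ⟨P.1.length, P, rfl⟩

end BoundQuiver

/-- The (left) global dimension of a ring: the supremum of the projective dimensions of its left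
modules. -/
def globalDimension (R : Type u) [Ring R] : WithBot ℕ∞ :=
  ⨆ M : ModuleCat.{u} R, projectiveDimension M

end

/-!
The integral of `x ↦ x` against the measure of `ln tˡ` over `[1, 2]` is `∫₁² x · (l / x) dx = l`, so
the claim is that `gl.dim A` is the greatest length of a permitted thread of `A^!`.

Let `S` be the set of paths of length two that generates `I`. The paths without factors in `S` form
a basis of `A` (`coeff_eq_zero_of_avoids`, `eq_zero_of_monomialCoeff`). For an arrow `β : b ⟶ c`,
right multiplication by `β` maps `A e_b` onto the left ideal `A β`; comparing coefficients, its
kernel is `A α` if there is an arrow `α` with `αβ ∈ S`, and `0` if there is none. Such an `α` is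
unique in a gentle algebra. So `A β` has a resolution by the modules `A e_v` whose syzygies are
`A α₁`, `A α₂`, …, where `⋯ α₂ α₁ β` is the path that is continued to the left by relations
(`LeftChain`, `principalResolution_arrowClass`).

* Upper bound: a module annihilated by all arrows is a direct sum of simple modules
  `A e_v / rad (A e_v)`, and `rad (A e_v)` is the direct sum of the left ideals `A α` for the arrows
  `α` ending at `v`. Hence the projective dimension of such a module is at most the length of the
  longest path all of whose factors of length two are relations
  (`hasProjectiveDimensionLT_of_arrowClass_smul`). Long paths vanish in a finite-dimensional `A`, so
  every module has a finite filtration with quotients of this kind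
  (`hasProjectiveDimensionLT_of_length_smul`).
* Lower bound: an arrow `α` is not of the form `α x α` in `A`, so `A α` is a direct summand
  neither of `A e_v`, for the target `v` of `α`, nor of `A` (`comp_ne_id_of_ne_mul_mul`). So none of
  the exact sequences above splits, each raises the projective dimension by one, and so does
  `0 → A β → A → A / A β → 0` (`le_globalDimension_of_leftChain`).

Read in the opposite quiver, the paths all of whose factors of length two are relations are the
paths without factors in the relations of `A^!`, and the longest of them are permitted threads
(`exists_globalDimension_eq_isGreatest`). If there are no arrows, the trivial paths are the threads.
-/

noncomputable section

/-! ### Projective dimension over a ring -/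

section Ring

universe r

variable {R : Type r} [Ring R]

theorem hasProjectiveDimensionLT_succ_of_exact {K P M : Type r} [AddCommGroup K] [AddCommGroup P]
    [AddCommGroup M] [Module R K] [Module R P] [Module R M] [Module.Projective R P]
    {f : K →ₗ[R] P} {g : P →ₗ[R] M} (hf : Function.Injective f) (hg : Function.Surjective g)
    (hfg : Function.Exact f g) {n : ℕ} (hK : HasProjectiveDimensionLT (ModuleCat.of R K) n) :
    HasProjectiveDimensionLT (ModuleCat.of R M) (n + 1) := by
  have hS : (ModuleCat.shortComplexOfCompEqZero f g hfg.linearMap_comp_eq_zero).ShortExact :=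
    ModuleCat.shortComplex_shortExact _ hfg hf hg
  have : Projective (ModuleCat.of R P) := ModuleCat.projective_of_categoryTheory_projective _
  exact hS.hasProjectiveDimensionLT_X₃ n hK
    (hasProjectiveDimensionLT_of_ge (ModuleCat.of R P) 1 (n + 1) (by lia))

/-- If `0 → K → P → M → 0` is a non-split exact sequence with `P` projective, then passing from
`K` to `M` raises the projective dimension by one. -/
theorem not_hasProjectiveDimensionLT_succ_of_exact {K P M : Type r} [AddCommGroup K]
    [AddCommGroup P] [AddCommGroup M] [Module R K] [Module R P] [Module R M]
    [Module.Projective R P]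
    {f : K →ₗ[R] P} {g : P →ₗ[R] M} (hf : Function.Injective f) (hg : Function.Surjective g)
    (hfg : Function.Exact f g) (hns : ∀ s : P →ₗ[R] K, s ∘ₗ f ≠ LinearMap.id) {n : ℕ}
    (hK : ¬ HasProjectiveDimensionLT (ModuleCat.of R K) n) :
    ¬ HasProjectiveDimensionLT (ModuleCat.of R M) (n + 1) := by
  intro hM
  have hS : (ModuleCat.shortComplexOfCompEqZero f g hfg.linearMap_comp_eq_zero).ShortExact :=
    ModuleCat.shortComplex_shortExact _ hfg hf hg
  have hP : Projective (ModuleCat.of R P) := ModuleCat.projective_of_categoryTheory_projective _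
  cases n with
  | zero =>
    have hp : Projective (ModuleCat.of R M) :=
      projective_iff_hasProjectiveDimensionLT_one.2 hM
    have : Module.Projective R M := (IsProjective.iff_projective _).2 hp
    obtain ⟨s, hs⟩ := Module.projective_lifting_property g LinearMap.id hg
    obtain ⟨t, ht⟩ := ((hfg.split_tfae hf hg).out 0 1 rfl rfl).1 ⟨s, hs⟩
    exact hns t ht
  | succ n => exact hK ((hS.hasProjectiveDimensionLT_X₃_iff n hP).1 hM)

theorem projective_span_of_isIdempotentElem {e : R} (he : IsIdempotentElem e) :
    Module.Projective R (Ideal.span {e}) := by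
  refine Module.Projective.of_split (M := R) (Ideal.span {e}).subtype
    ((LinearMap.toSpanSingleton R R e).codRestrict _ fun x =>
      Ideal.mul_mem_left _ x (Ideal.mem_span_singleton_self e)) ?_
  ext ⟨x, hx⟩
  obtain ⟨y, rfl⟩ := Ideal.mem_span_singleton'.1 hx
  change y * e * e = y * e
  rw [mul_assoc, he.eq]

/-- The left ideal `R c` has a resolution of length `< n` of the following special kind: each
syzygy is again a principal left ideal, `0 → R d → R e → R c → 0` with an idempotent `e`, and the
resolution ends with the left ideal `0`. -/
inductive PrincipalResolution : ℕ → R → Prop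
  | zero (n : ℕ) : PrincipalResolution n 0
  | succ {n : ℕ} {c d e : R} (hd : PrincipalResolution n d) (he : IsIdempotentElem e)
      (hec : e * c = c) (hde : d * e = d) (hdc : d * c = 0)
      (hker : ∀ x, x * e = x → x * c = 0 → ∃ y, x = y * d) : PrincipalResolution (n + 1) c

/-- A left ideal with a resolution of length `< n + 1` has a first syzygy also if it is zero, where
`d = e = 0` will do. -/
theorem PrincipalResolution.exists_of_succ {n : ℕ} {c : R} (h : PrincipalResolution (n + 1) c) :
    ∃ d e : R, PrincipalResolution n d ∧ IsIdempotentElem e ∧ e * c = c ∧ d * e = d ∧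
      d * c = 0 ∧ ∀ x, x * e = x → x * c = 0 → ∃ y, x = y * d := by
  cases h with
  | zero =>
    exact ⟨0, 0, .zero n, .zero, by simp, by simp, by simp,
      fun x hx _ => ⟨0, by simpa using hx.symm⟩⟩
  | succ hd he hec hde hdc hker => exact ⟨_, _, hd, he, hec, hde, hdc, hker⟩

theorem PrincipalResolution.eq_zero {c : R} (h : PrincipalResolution 0 c) : c = 0 := by
  cases h
  rfl

/-- Right multiplication by `c`, as a map from the left ideal `R a` to the left ideal `R b`. -/
def spanMulRight (a b c : R) (h : a * c ∈ Ideal.span {b}) : Ideal.span {a} →ₗ[R] Ideal.span {b} :=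
  (LinearMap.toSpanSingleton R R c).restrict fun x hx => by
    obtain ⟨y, rfl⟩ := Ideal.mem_span_singleton'.1 hx
    simpa [mul_assoc] using Ideal.mul_mem_left _ y h

theorem spanMulRight_apply {a b c : R} (h : a * c ∈ Ideal.span {b}) (x : Ideal.span {a}) :
    (spanMulRight a b c h x : R) = x * c := rfl

theorem mem_span_idempotent {e x : R} (he : IsIdempotentElem e) (hx : x ∈ Ideal.span {e}) :
    x * e = x := by
  obtain ⟨y, rfl⟩ := Ideal.mem_span_singleton'.1 hx
  rw [mul_assoc, he.eq]

section Principal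

variable {c d e : R}

theorem spanMulRight_self_apply (hde : d * e = d) (h : d * e ∈ Ideal.span {e})
    (x : Ideal.span {d}) : (spanMulRight d e e h x : R) = x := by
  obtain ⟨x, hx⟩ := x
  obtain ⟨y, rfl⟩ := Ideal.mem_span_singleton'.1 hx
  rw [spanMulRight_apply, mul_assoc, hde]

theorem spanMulRight_self_injective (hde : d * e = d) (h : d * e ∈ Ideal.span {e}) :
    Function.Injective (spanMulRight d e e h) := by
  intro x y hxy
  have := congrArg Subtype.val hxy
  rw [spanMulRight_self_apply hde, spanMulRight_self_apply hde] at this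
  exact Subtype.ext this

theorem spanMulRight_surjective (hec : e * c = c) (h : e * c ∈ Ideal.span {c}) :
    Function.Surjective (spanMulRight e c c h) := by
  rintro ⟨x, hx⟩
  obtain ⟨y, rfl⟩ := Ideal.mem_span_singleton'.1 hx
  exact ⟨⟨y * e, Ideal.mul_mem_left _ y (Ideal.mem_span_singleton_self e)⟩,
    Subtype.ext (by rw [spanMulRight_apply, mul_assoc, hec])⟩

theorem spanMulRight_exact (he : IsIdempotentElem e) (hde : d * e = d) (hdc : d * c = 0)
    (hker : ∀ x, x * e = x → x * c = 0 → ∃ y, x = y * d) (h : d * e ∈ Ideal.span {e})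
    (h' : e * c ∈ Ideal.span {c}) :
    Function.Exact (spanMulRight d e e h) (spanMulRight e c c h') := by
  rintro ⟨x, hx⟩
  rw [Subtype.ext_iff, spanMulRight_apply]
  constructor
  · intro hxc
    obtain ⟨y, hy⟩ := hker x (mem_span_idempotent he hx) hxc
    refine ⟨⟨y * d, Ideal.mul_mem_left _ y (Ideal.mem_span_singleton_self d)⟩, Subtype.ext ?_⟩
    rw [spanMulRight_apply]
    simp [mul_assoc, hde, hy]
  · rintro ⟨⟨y, hy⟩, hyx⟩
    obtain ⟨t, rfl⟩ := Ideal.mem_span_singleton'.1 hy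
    rw [Subtype.ext_iff, spanMulRight_apply] at hyx
    simp only [mul_assoc, hde] at hyx
    simp [← hyx, mul_assoc, hdc]

end Principal

/-- A direct sum of left ideals that have principal resolutions of length `< n` has projective
dimension `< n`: the direct sum of the resolutions is a resolution. -/
theorem hasProjectiveDimensionLT_dfinsupp_span {n : ℕ} :
    ∀ {ι : Type r} (c : ι → R), (∀ i, PrincipalResolution n (c i)) →
      HasProjectiveDimensionLT (ModuleCat.of R (Π₀ i, Ideal.span {c i})) n := by
  induction n with
  | zero =>
    intro ι c h
    have h0 : ∀ i, c i = 0 := fun i => (h i).eq_zero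
    refine Limits.IsZero.hasProjectiveDimensionLT_zero ?_
    rw [ModuleCat.isZero_iff_subsingleton]
    refine ⟨fun x y => DFinsupp.ext fun i => Subtype.ext ?_⟩
    have : ∀ t : Ideal.span {c i}, (t : R) = 0 := by
      rintro ⟨t, ht⟩
      obtain ⟨y, rfl⟩ := Ideal.mem_span_singleton'.1 ht
      simp [h0]
    rw [this, this]
  | succ n ih =>
    intro ι c h
    choose d e hd he hec hde hdc hker using fun i => (h i).exists_of_succ
    have h1 : ∀ i, d i * e i ∈ Ideal.span {e i} := fun i =>
      Ideal.mul_mem_left _ _ (Ideal.mem_span_singleton_self _)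
    have h2 : ∀ i, e i * c i ∈ Ideal.span {c i} := fun i =>
      Ideal.mul_mem_left _ _ (Ideal.mem_span_singleton_self _)
    have : ∀ i, Module.Projective R (Ideal.span {e i}) := fun i =>
      projective_span_of_isIdempotentElem (he i)
    refine hasProjectiveDimensionLT_succ_of_exact (K := Π₀ i, Ideal.span {d i})
      (P := Π₀ i, Ideal.span {e i})
      (f := DFinsupp.mapRange.linearMap fun i => spanMulRight (d i) (e i) (e i) (h1 i))
      (g := DFinsupp.mapRange.linearMap fun i => spanMulRight (e i) (c i) (c i) (h2 i))
      ?_ ?_ ?_ (ih d hd)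
    · exact (DFinsupp.mapRange_injective _ fun i => map_zero _).2 fun i =>
        spanMulRight_self_injective (hde i) (h1 i)
    · exact (DFinsupp.mapRange_surjective _ fun i => map_zero _).2 fun i =>
        spanMulRight_surjective (hec i) (h2 i)
    · have hex := fun i => spanMulRight_exact (he i) (hde i) (hdc i) (hker i) (h1 i) (h2 i)
      classical
      rw [LinearMap.exact_iff]
      rw [DFinsupp.ker_mapRangeLinearMap, DFinsupp.range_mapRangeLinearMap]
      exact congrArg (fun p : ∀ i, Submodule R (Ideal.span {e i}) =>
        (Submodule.pi Set.univ p).comap (DFinsupp.coeFnLinearMap R))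
        (funext fun i => LinearMap.exact_iff.1 (hex i))

theorem hasProjectiveDimensionLT_succ_of_exact_dfinsupp {n : ℕ} {ι κ : Type r} {c : κ → R}
    {e : ι → R} (hc : ∀ j, PrincipalResolution n (c j)) (he : ∀ i, IsIdempotentElem (e i))
    {M : Type r} [AddCommGroup M] [Module R M]
    {f : (Π₀ j, Ideal.span {c j}) →ₗ[R] Π₀ i, Ideal.span {e i}}
    {g : (Π₀ i, Ideal.span {e i}) →ₗ[R] M} (hf : Function.Injective f)
    (hg : Function.Surjective g) (hfg : Function.Exact f g) :
    HasProjectiveDimensionLT (ModuleCat.of R M) (n + 1) :=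
  have := fun i => projective_span_of_isIdempotentElem (he i)
  hasProjectiveDimensionLT_succ_of_exact hf hg hfg (hasProjectiveDimensionLT_dfinsupp_span c hc)

/-- If `c` is not of the form `c x c`, then the left ideal `R c` is not a direct summand of a left
ideal that contains a right unit for `c`. -/
theorem comp_ne_id_of_ne_mul_mul {c : R} (hc : ∀ x, c ≠ c * x * c) {P : Ideal R} {e : P}
    (he : c * (e : R) = c) {f : Ideal.span {c} →ₗ[R] P} (hf : ∀ x, (f x : R) = x)
    (s : P →ₗ[R] Ideal.span {c}) : s ∘ₗ f ≠ LinearMap.id := by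
  intro h
  let x : Ideal.span {c} := ⟨c, Ideal.mem_span_singleton_self c⟩
  obtain ⟨y, hy⟩ := Ideal.mem_span_singleton'.1 (s e).2
  have h1 : f x = c • e := Subtype.ext ((hf x).trans he.symm)
  have h2 : s (f x) = x := LinearMap.congr_fun h x
  rw [h1, map_smul] at h2
  have h3 : c * (s e : R) = c := congrArg Subtype.val h2
  rw [← hy, ← mul_assoc] at h3
  exact hc y h3.symm

theorem subtype_comp_ne_id_of_ne_mul_mul {c : R} (hc : ∀ x, c ≠ c * x * c)
    (s : R →ₗ[R] Ideal.span {c}) : s ∘ₗ (Ideal.span {c}).subtype ≠ LinearMap.id :=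
  comp_ne_id_of_ne_mul_mul hc (P := ⊤) (e := ⟨1, trivial⟩) (mul_one c)
    (f := Submodule.inclusion le_top) (fun _ => rfl) (s ∘ₗ (⊤ : Ideal R).subtype)

end Ring

/-! ### Paths without forbidden factors -/

section Paths

variable {V : Type u} [Quiver.{w} V]

/-- The path `p` has no factor of length two in the set `S`. -/
def Quiver.Path.Avoids (S : Set (QPath V)) {a e : V} (p : Quiver.Path a e) : Prop :=
  ∀ ⦃b c d : V⦄ (p' : Quiver.Path a b) (α : b ⟶ c) (β : c ⟶ d) (q : Quiver.Path d e),
    p = ((p'.cons α).cons β).comp q → QPath.two α β ∉ S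

/-- An arrow as a path of length one. -/
def QPath.arrow {a b : V} (α : a ⟶ b) : QPath V := ⟨a, b, Quiver.Path.nil.cons α⟩

namespace Quiver.Path

variable {S : Set (QPath V)}

theorem avoids_nil (a : V) : (Quiver.Path.nil : Quiver.Path a a).Avoids S := by
  intro b c d p' α β q h
  have := congrArg Quiver.Path.length h
  simp at this
  lia

theorem avoids_nil_cons {a b : V} (α : a ⟶ b) :
    ((Quiver.Path.nil : Quiver.Path a a).cons α).Avoids S := by
  intro b c d p' α β q h
  have := congrArg Quiver.Path.length h
  simp at this
  lia

theorem avoids_cons_cons {a b c d : V} {p : Quiver.Path a b} {α : b ⟶ c} {β : c ⟶ d} :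
    ((p.cons α).cons β).Avoids S ↔ (p.cons α).Avoids S ∧ QPath.two α β ∉ S := by
  constructor
  · intro h
    refine ⟨fun _ _ _ p' α' β' q e => h p' α' β' (q.cons β) (by rw [e]; rfl), h p α β .nil rfl⟩
  · rintro ⟨h, h'⟩ b' c' d' p' α' β' q e
    cases q with
    | nil =>
      simp only [Quiver.Path.comp_nil] at e
      cases e
      exact h'
    | cons q γ =>
      obtain ⟨rfl, h₁, h₂⟩ := Quiver.Path.cons.inj e
      exact h p' α' β' q (eq_of_heq h₁)

theorem avoids_toPath_comp_toPath_comp {a b c : V} {α : a ⟶ b} {β : b ⟶ c} :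
    ∀ {d : V} {q : Quiver.Path c d}, (α.toPath.comp (β.toPath.comp q)).Avoids S ↔
      QPath.two α β ∉ S ∧ (β.toPath.comp q).Avoids S
  | _, .nil => by
    have : (β.toPath.comp .nil).Avoids S := avoids_nil_cons β
    refine (avoids_cons_cons (p := .nil) (α := α) (β := β)).trans ?_
    simp only [avoids_nil_cons, true_and]
    exact ⟨fun h => ⟨h, this⟩, And.left⟩
  | _, .cons .nil γ => by
    have h1 := avoids_cons_cons (S := S) (p := Quiver.Path.nil.cons α) (α := β) (β := γ)
    have h0 := avoids_cons_cons (S := S) (p := Quiver.Path.nil) (α := α) (β := β)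
    have h2 := avoids_cons_cons (S := S) (p := Quiver.Path.nil) (α := β) (β := γ)
    simp only [avoids_nil_cons, true_and] at h0 h2
    rw [h0] at h1
    exact h1.trans (and_congr_right' h2.symm)
  | _, .cons (.cons q δ) γ => by
    have ih := avoids_toPath_comp_toPath_comp (α := α) (β := β) (q := q.cons δ)
    have h1 := avoids_cons_cons (S := S) (p := α.toPath.comp (β.toPath.comp q)) (α := δ) (β := γ)
    have h2 := avoids_cons_cons (S := S) (p := β.toPath.comp q) (α := δ) (β := γ)
    simp only [Quiver.Path.comp_cons] at ih ⊢
    rw [h1, h2, ih, and_assoc]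

end Quiver.Path

theorem QPath.exists_two_of_length {p : QPath V} (h : p.length = 2) :
    ∃ (a b c : V) (α : a ⟶ b) (β : b ⟶ c), p = QPath.two α β := by
  obtain ⟨a, b, p⟩ := p
  match p, h with
  | .cons (.cons .nil α) β, _ => exact ⟨_, _, _, α, β, rfl⟩

end Paths

/-! ### Coefficients and quadratic monomial ideals -/

section Coefficients

variable {𝕜 : Type z} [Field 𝕜] {V : Type u} [Quiver.{w} V]

namespace PathAlgebra

theorem mul_of (x y : QPath V) : (of x * of y : PathAlgebra 𝕜 V) = mulPath x y := mulLin_of_of x y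

theorem mulPath_arrow {s a b : V} (q : Quiver.Path s a) (α : a ⟶ b) :
    (mulPath ⟨s, a, q⟩ (QPath.arrow α) : PathAlgebra 𝕜 V) = of ⟨s, b, q.cons α⟩ :=
  mulPath_eq_of (p := ⟨s, a, q⟩) (q := QPath.arrow α) rfl

variable [Finite V]


/-- On the two-sided ideal generated by a set `S` of paths of length two, the coefficient of a path
without factors in `S` vanishes. -/
theorem coeff_eq_zero_of_avoids {S : Set (QPath V)} (hS : ∀ p ∈ S, p.length = 2) {P : QPath V}
    (hP : P.path.Avoids S) {x : PathAlgebra 𝕜 V}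
    (hx : x ∈ TwoSidedIdeal.span (of '' S : Set (PathAlgebra 𝕜 V))) : coeff P x = 0 := by
  rw [TwoSidedIdeal.mem_span_iff_mem_addSubgroup_closure] at hx
  induction hx using AddSubgroup.closure_induction with
  | zero => simp
  | add x y _ _ hx hy => rw [map_add, hx, hy, add_zero]
  | neg x _ hx => rw [map_neg, hx, neg_zero]
  | mem x hx =>
    obtain ⟨_, ⟨y, -, _, ⟨s, hs, rfl⟩, rfl⟩, y', -, rfl⟩ := hx
    obtain ⟨a, b, c, α, β, rfl⟩ := QPath.exists_two_of_length (hS s hs)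
    induction y using induction with
    | zero => simp
    | add y z hy hz => simp only [add_mul, map_add] at hy hz ⊢; rw [hy, hz, add_zero]
    | smul_of k p =>
      induction y' using induction with
      | zero => simp
      | add y z hy hz => simp only [mul_add, map_add] at hy hz ⊢; rw [hy, hz, add_zero]
      | smul_of k' q =>
        simp only [Algebra.smul_mul_assoc, Algebra.mul_smul_comm, map_smul]
        suffices h : coeff P (of p * of (QPath.two α β) * of q : PathAlgebra 𝕜 V) = 0 by simp [h]
        simp only [mul_def, mulLin_of_of]
        by_cases hp : p.target = a
        · by_cases hq : c = q.source
          · rw [mulPath_eq_of (q := QPath.two α β) hp, mulLin_of_of,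
              mulPath_eq_of (p := p.comp (QPath.two α β) hp) hq]
            refine coeff_of_ne fun hPe => ?_
            obtain ⟨p₁, p₂, p⟩ := p
            obtain ⟨q₁, q₂, q⟩ := q
            dsimp only at hp hq
            subst hp hq
            subst hPe
            exact hP p α β q (by simp [QPath.comp, QPath.two]) hs
          · rw [mulPath_eq_of (q := QPath.two α β) hp, mulLin_of_of,
              mulPath_eq_zero (p := p.comp (QPath.two α β) hp) hq, map_zero]
        · rw [mulPath_eq_zero (q := QPath.two α β) hp, map_zero, LinearMap.zero_apply, map_zero]

/-- A path of length two lies in the ideal generated by a set `S` of such paths only if it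
belongs to `S`. -/
theorem twoPath_mem_span_iff {S : Set (QPath V)} (hS : ∀ p ∈ S, p.length = 2) {a b c : V}
    {α : a ⟶ b} {β : b ⟶ c} :
    (twoPath α β : PathAlgebra 𝕜 V) ∈ TwoSidedIdeal.span (of '' S : Set (PathAlgebra 𝕜 V)) ↔
      QPath.two α β ∈ S := by
  refine ⟨fun h => ?_, fun h => TwoSidedIdeal.subset_span ⟨_, h, rfl⟩⟩
  by_contra h'
  have := coeff_eq_zero_of_avoids hS (P := QPath.two α β)
    (Quiver.Path.avoids_cons_cons.2 ⟨Quiver.Path.avoids_nil_cons α, h'⟩) h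
  rw [twoPath, coeff_of_self] at this
  exact one_ne_zero this

theorem coeff_cons_mul_arrow (x : PathAlgebra 𝕜 V) {s a b : V} (p : Quiver.Path s a) (α : a ⟶ b) :
    coeff ⟨s, b, p.cons α⟩ (x * of (QPath.arrow α)) = coeff ⟨s, a, p⟩ x := by
  induction x using induction with
  | zero => simp
  | add x y hx hy => rw [add_mul, map_add, map_add, hx, hy]
  | smul_of c q =>
    rw [Algebra.smul_mul_assoc, map_smul, map_smul, mul_of]
    congr 1
    obtain ⟨s', a', q⟩ := q
    by_cases h : a' = a
    · subst h
      rw [mulPath_arrow]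
      by_cases h' : (⟨s', a', q⟩ : QPath V) = ⟨s, a', p⟩
      · cases h'
        rw [coeff_of_self, coeff_of_self]
      · rw [coeff_of_ne h', coeff_of_ne]
        intro h''
        cases h''
        exact h' rfl
    · rw [mulPath_eq_zero (p := ⟨s', a', q⟩) (q := QPath.arrow α) h, coeff_of_ne, map_zero]
      intro h'
      cases h'
      exact h rfl

theorem coeff_mul_arrow_of_ne (x : PathAlgebra 𝕜 V) {a b : V} (α : a ⟶ b) {p : QPath V}
    (hp : ∀ (s : V) (q : Quiver.Path s a), p ≠ ⟨s, b, q.cons α⟩) :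
    coeff p (x * of (QPath.arrow α)) = 0 := by
  induction x using induction with
  | zero => simp
  | add x y hx hy => rw [add_mul, map_add, hx, hy, add_zero]
  | smul_of c q =>
    rw [Algebra.smul_mul_assoc, map_smul, mul_of]
    obtain ⟨s', a', q⟩ := q
    by_cases h : a' = a
    · subst h
      rw [mulPath_arrow, coeff_of_ne (hp s' q).symm, smul_zero]
    · rw [mulPath_eq_zero (p := ⟨s', a', q⟩) (q := QPath.arrow α) h, map_zero, smul_zero]

theorem coeff_mul_trivial (x : PathAlgebra 𝕜 V) (v : V) {s t : V} (p : Quiver.Path s t) :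
    coeff ⟨s, t, p⟩ (x * of (QPath.trivial v)) = open Classical in
      if t = v then coeff ⟨s, t, p⟩ x else 0 := by
  classical
  induction x using induction with
  | zero => simp
  | add x y hx hy => rw [add_mul, map_add, map_add, hx, hy]; split_ifs <;> simp
  | smul_of c q =>
    rw [Algebra.smul_mul_assoc, map_smul, map_smul, mul_of, mulPath_trivial_right]
    split_ifs with h h' h'
    · rfl
    · rw [coeff_of_ne, smul_zero]
      rintro rfl
      exact h' h
    · rw [coeff_of_ne, smul_zero, map_zero, smul_zero]
      rintro rfl
      exact h h'
    · rw [map_zero, smul_zero]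

theorem coeff_trivial_arrow_mul (x : PathAlgebra 𝕜 V) {a b : V} (α : a ⟶ b) (v : V) :
    coeff (QPath.trivial v) (of (QPath.arrow α) * x) = 0 := by
  induction x using induction with
  | zero => simp
  | add x y hx hy => rw [mul_add, map_add, hx, hy, add_zero]
  | smul_of c q =>
    rw [Algebra.mul_smul_comm, map_smul, mul_of]
    by_cases h : b = q.source
    · rw [mulPath_eq_of (p := QPath.arrow α) h, coeff_of_ne, smul_zero]
      intro h'
      have := congrArg QPath.length h'
      simp [QPath.comp, QPath.arrow, QPath.length, QPath.trivial] at this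
    · rw [mulPath_eq_zero (p := QPath.arrow α) h, map_zero, smul_zero]

/-- Division with remainder by an arrow `α` on the right: collecting the paths that end with `α`. -/
theorem exists_eq_mul_arrow_add (x : PathAlgebra 𝕜 V) {a b : V} (α : a ⟶ b) :
    ∃ y t : PathAlgebra 𝕜 V, x = y * of (QPath.arrow α) + t ∧
      ∀ (s : V) (q : Quiver.Path s a), coeff ⟨s, b, q.cons α⟩ t = 0 := by
  induction x using induction with
  | zero => exact ⟨0, 0, by simp, by simp⟩
  | add x x' hx hx' =>
    obtain ⟨y, t, rfl, h⟩ := hx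
    obtain ⟨y', t', rfl, h'⟩ := hx'
    exact ⟨y + y', t + t', by rw [add_mul]; abel, fun s q => by rw [map_add, h, h', add_zero]⟩
  | smul_of c p =>
    by_cases h : ∃ (s : V) (q : Quiver.Path s a), p = ⟨s, b, q.cons α⟩
    · obtain ⟨s, q, rfl⟩ := h
      exact ⟨c • of ⟨s, a, q⟩, 0,
        by rw [Algebra.smul_mul_assoc, mul_of, mulPath_arrow, add_zero], by simp⟩
    · push Not at h
      exact ⟨0, c • of p, by simp, fun s q => by rw [map_smul, coeff_of_ne (h s q), smul_zero]⟩

end PathAlgebra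

end Coefficients

/-! ### The basis of a quadratic monomial algebra -/

section QuadraticMonomial

open PathAlgebra

variable {𝕜 : Type z} [Field 𝕜] {V : Type u} [Quiver.{w} V] [Finite V]

/-- The projection of the path algebra onto the algebra of a bound quiver. -/
def boundProj (I : TwoSidedIdeal (PathAlgebra 𝕜 V)) :
    PathAlgebra 𝕜 V →ₐ[𝕜] BoundQuiverAlgebra I :=
  I.ringCon.mkₐ 𝕜

theorem boundProj_surjective (I : TwoSidedIdeal (PathAlgebra 𝕜 V)) :
    Function.Surjective (boundProj I) :=
  I.ringCon.mkₐ_surjective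

theorem boundProj_eq_zero_iff {I : TwoSidedIdeal (PathAlgebra 𝕜 V)} {x : PathAlgebra 𝕜 V} :
    boundProj I x = 0 ↔ x ∈ I := by
  have h : I.ringCon.mk' x = 0 ↔ x ∈ I := by
    rw [← TwoSidedIdeal.mem_ker, TwoSidedIdeal.ker_ringCon_mk']
  exact h

/-- The class of the trivial path at `v`. -/
def vertexIdem (I : TwoSidedIdeal (PathAlgebra 𝕜 V)) (v : V) : BoundQuiverAlgebra I :=
  boundProj I (of (QPath.trivial v))

/-- The class of the arrow `α`. -/
def arrowClass (I : TwoSidedIdeal (PathAlgebra 𝕜 V)) {a b : V} (α : a ⟶ b) :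
    BoundQuiverAlgebra I :=
  boundProj I (of (QPath.arrow α))

section Relations

variable (I : TwoSidedIdeal (PathAlgebra 𝕜 V))

theorem isIdempotentElem_vertexIdem (v : V) : IsIdempotentElem (vertexIdem I v) := by
  classical
  rw [IsIdempotentElem, vertexIdem, ← map_mul, mul_of, mulPath_trivial_left]
  exact congrArg _ (if_pos rfl)

theorem vertexIdem_mul_arrowClass {a b : V} (α : a ⟶ b) :
    vertexIdem I a * arrowClass I α = arrowClass I α := by
  classical
  rw [vertexIdem, arrowClass, ← map_mul, mul_of, mulPath_trivial_left]
  exact congrArg _ (if_pos rfl)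

theorem arrowClass_mul_vertexIdem {a b : V} (α : a ⟶ b) :
    arrowClass I α * vertexIdem I b = arrowClass I α := by
  classical
  rw [vertexIdem, arrowClass, ← map_mul, mul_of, mulPath_trivial_right]
  exact congrArg _ (if_pos rfl)

theorem arrowClass_mul_arrowClass {a b c : V} (α : a ⟶ b) (β : b ⟶ c) :
    arrowClass I α * arrowClass I β = boundProj I (twoPath α β) := by
  rw [arrowClass, arrowClass, ← map_mul, mul_of]
  exact congrArg _ (mulPath_arrow (Quiver.Path.nil.cons α) β)

theorem boundProj_cons {s a b : V} (p : Quiver.Path s a) (α : a ⟶ b) :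
    boundProj I (of ⟨s, b, p.cons α⟩) = boundProj I (of ⟨s, a, p⟩) * arrowClass I α := by
  rw [arrowClass, ← map_mul, mul_of, mulPath_arrow]

theorem sum_vertexIdem [Fintype V] : ∑ v, vertexIdem I v = 1 := by
  simp only [vertexIdem]
  rw [← map_sum, ← one_def, map_one]

theorem boundProj_comp {a b c : V} (p : Quiver.Path a b) (q : Quiver.Path b c) :
    boundProj I (of ⟨a, c, p.comp q⟩) =
      boundProj I (of ⟨a, b, p⟩) * boundProj I (of ⟨b, c, q⟩) := by
  rw [← map_mul, mul_of, mulPath_eq_of (p := ⟨a, b, p⟩) (q := ⟨b, c, q⟩) rfl]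
  rfl

end Relations

/-- The two-sided ideal of the path algebra generated by a set of paths. -/
def monomialIdeal (𝕜 : Type z) [Field 𝕜] (S : Set (QPath V)) : TwoSidedIdeal (PathAlgebra 𝕜 V) :=
  TwoSidedIdeal.span (of '' S)

variable {S : Set (QPath V)}

theorem of_mem_monomialIdeal_of_not_avoids {P : QPath V} (hP : ¬ P.path.Avoids S) :
    (of P : PathAlgebra 𝕜 V) ∈ monomialIdeal 𝕜 S := by
  obtain ⟨a, b, P⟩ := P
  simp only [Quiver.Path.Avoids, not_forall, not_not] at hP
  obtain ⟨c, d, e, p, α, β, q, rfl, h⟩ := hP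
  rw [← boundProj_eq_zero_iff, boundProj_comp, boundProj_cons, boundProj_cons,
    mul_assoc (boundProj _ _), arrowClass_mul_arrowClass]
  have : boundProj (monomialIdeal 𝕜 S) (twoPath α β) = 0 :=
    boundProj_eq_zero_iff.2 (TwoSidedIdeal.subset_span ⟨_, h, rfl⟩)
  rw [this, mul_zero, zero_mul]

theorem boundProj_eq_sum (I : TwoSidedIdeal (PathAlgebra 𝕜 V)) (x : PathAlgebra 𝕜 V) :
    ∃ s : Finset (QPath V), boundProj I x = ∑ p ∈ s, coeff p x • boundProj I (of p) := by
  refine ⟨Finsupp.support (M := 𝕜) x, ?_⟩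
  simp only [← map_smul, ← map_sum]
  congr 1
  have h : ∀ p c, (c • of p : PathAlgebra 𝕜 V) = (Finsupp.single p c : QPath V →₀ 𝕜) := by
    intro p c
    change (c • Finsupp.single p (1 : 𝕜) : QPath V →₀ 𝕜) = _
    rw [Finsupp.smul_single, smul_eq_mul, mul_one]
  simp only [h]
  exact (Finsupp.sum_single (M := 𝕜) x).symm

/-- The coefficient of a path without factors in `S`, as a functional on the quotient of the path
algebra by the ideal generated by `S`. -/
def monomialCoeff (hS : ∀ p ∈ S, p.length = 2) {P : QPath V} (hP : P.path.Avoids S) :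
    BoundQuiverAlgebra (monomialIdeal 𝕜 S) →ₗ[𝕜] 𝕜 where
  toFun := Quotient.lift (s := (monomialIdeal 𝕜 S).ringCon.toSetoid) (coeff P) fun x y hxy => by
    rw [← sub_eq_zero, ← map_sub]
    exact coeff_eq_zero_of_avoids hS hP (((monomialIdeal 𝕜 S).rel_iff x y).1 hxy)
  map_add' := by
    rintro ⟨x⟩ ⟨y⟩
    exact map_add (coeff P) x y
  map_smul' := by
    rintro c ⟨x⟩
    exact map_smul (coeff P) c x

theorem monomialCoeff_boundProj (hS : ∀ p ∈ S, p.length = 2) {P : QPath V}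
    (hP : P.path.Avoids S) (x : PathAlgebra 𝕜 V) :
    monomialCoeff hS hP (boundProj (monomialIdeal 𝕜 S) x) = coeff P x := rfl

theorem eq_zero_of_monomialCoeff (hS : ∀ p ∈ S, p.length = 2)
    {x : BoundQuiverAlgebra (monomialIdeal 𝕜 S)}
    (h : ∀ (P : QPath V) (hP : P.path.Avoids S), monomialCoeff hS hP x = 0) : x = 0 := by
  obtain ⟨x, rfl⟩ := boundProj_surjective _ x
  obtain ⟨s, hs⟩ := boundProj_eq_sum (monomialIdeal 𝕜 S) x
  rw [hs]
  refine Finset.sum_eq_zero fun p _ => ?_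
  by_cases hp : p.path.Avoids S
  · rw [← monomialCoeff_boundProj hS hp, h, zero_smul]
  · rw [boundProj_eq_zero_iff.2 (of_mem_monomialIdeal_of_not_avoids hp), smul_zero]

/-- If the algebra is finite-dimensional, all long paths lie in the ideal, because the paths
outside the ideal are linearly independent. -/
theorem exists_forall_length_boundProj_eq_zero (hS : ∀ p ∈ S, p.length = 2)
    (hfin : Module.Finite 𝕜 (BoundQuiverAlgebra (monomialIdeal 𝕜 S))) :
    ∃ N : ℕ, ∀ p : QPath V, N ≤ p.length → boundProj (monomialIdeal 𝕜 S) (of p) = 0 := by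
  have hli : LinearIndependent 𝕜 fun p : {p : QPath V // p.path.Avoids S} =>
      boundProj (monomialIdeal 𝕜 S) (of p.1) := by
    rw [linearIndependent_iff']
    intro s g hg p hp
    have := congrArg (monomialCoeff hS p.2) hg
    rw [map_sum, map_zero, Finset.sum_eq_single_of_mem p hp] at this
    · rwa [map_smul, monomialCoeff_boundProj, coeff_of_self, smul_eq_mul, mul_one] at this
    · intro q _ hq
      rw [map_smul, monomialCoeff_boundProj, coeff_of_ne fun h => hq (Subtype.ext h), smul_zero]
  have := hli.finite
  obtain ⟨N, hN⟩ :=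
    (Set.finite_range fun p : {p : QPath V // p.path.Avoids S} => p.1.length).bddAbove
  refine ⟨N + 1, fun p hp => ?_⟩
  rw [boundProj_eq_zero_iff]
  refine of_mem_monomialIdeal_of_not_avoids fun h => ?_
  have := hN ⟨⟨p, h⟩, rfl⟩
  dsimp only at this
  lia

theorem monomialCoeff_mul_arrowClass_of_ne (hS : ∀ p ∈ S, p.length = 2)
    {P : QPath V} (hP : P.path.Avoids S) {a b : V}
    {α : a ⟶ b} (hne : ∀ (s : V) (q : Quiver.Path s a), P ≠ ⟨s, b, q.cons α⟩)
    (x : BoundQuiverAlgebra (monomialIdeal 𝕜 S)) :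
    monomialCoeff hS hP (x * arrowClass _ α) = 0 := by
  obtain ⟨x, rfl⟩ := boundProj_surjective _ x
  rw [arrowClass, ← map_mul, monomialCoeff_boundProj, coeff_mul_arrow_of_ne x α hne]

theorem arrowClass_ne_mul_mul (hS : ∀ p ∈ S, p.length = 2) {a b : V} (α : a ⟶ b)
    (x : BoundQuiverAlgebra (monomialIdeal 𝕜 S)) :
    arrowClass _ α ≠ arrowClass _ α * x * arrowClass _ α := by
  obtain ⟨x, rfl⟩ := boundProj_surjective _ x
  intro h
  rw [arrowClass, ← map_mul, ← map_mul] at h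
  have hP : (QPath.arrow α).path.Avoids S := Quiver.Path.avoids_nil_cons α
  have := congrArg (monomialCoeff hS hP) h
  rw [monomialCoeff_boundProj, monomialCoeff_boundProj, coeff_of_self] at this
  refine one_ne_zero (this.trans ?_)
  exact (coeff_cons_mul_arrow _ .nil α).trans (coeff_trivial_arrow_mul x α a)

/-! ### Syzygies of the left ideals generated by arrows -/

/-- A path whose coefficient in `x e_b` does not vanish, where `x β = 0`, ends with an arrow `α`
such that `αβ` is a relation. -/
theorem exists_eq_cons_of_coeff_ne_zero (hS : ∀ p ∈ S, p.length = 2)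
    {b c : V} {β : b ⟶ c} {x : PathAlgebra 𝕜 V}
    (hx : x * of (QPath.arrow β) ∈ monomialIdeal 𝕜 S) {s t : V} {p : Quiver.Path s t}
    (hp : p.Avoids S) (h : coeff ⟨s, t, p⟩ (x * of (QPath.trivial b)) ≠ 0) :
    ∃ (a : V) (α : a ⟶ b) (q : Quiver.Path s a), QPath.two α β ∈ S ∧
      (⟨s, t, p⟩ : QPath V) = ⟨s, b, q.cons α⟩ := by
  classical
  rw [coeff_mul_trivial] at h
  obtain rfl : t = b := by by_contra hne; exact h (if_neg hne)
  rw [if_pos rfl] at h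
  have hna : ¬ (p.cons β).Avoids S := fun ha =>
    h (by rw [← coeff_cons_mul_arrow x p β]; exact coeff_eq_zero_of_avoids hS ha hx)
  cases p with
  | nil => exact absurd (Quiver.Path.avoids_nil_cons β) hna
  | cons p γ =>
    rw [Quiver.Path.avoids_cons_cons, not_and, not_not] at hna
    exact ⟨_, γ, p, hna hp, rfl⟩

theorem exists_eq_mul_arrowClass (hS : ∀ p ∈ S, p.length = 2)
    {a b c : V} {α : a ⟶ b} {β : b ⟶ c}
    (huniq : ∀ (a' : V) (α' : a' ⟶ b), QPath.two α' β ∈ S →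
      (⟨a', α'⟩ : Σ a : V, (a ⟶ b)) = ⟨a, α⟩)
    {x : BoundQuiverAlgebra (monomialIdeal 𝕜 S)} (hxe : x * vertexIdem _ b = x)
    (hxβ : x * arrowClass _ β = 0) : ∃ y, x = y * arrowClass _ α := by
  obtain ⟨x, rfl⟩ := boundProj_surjective _ x
  rw [arrowClass, ← map_mul, boundProj_eq_zero_iff] at hxβ
  rw [vertexIdem, ← map_mul] at hxe
  obtain ⟨y, t, hyt, ht⟩ := exists_eq_mul_arrow_add (x * of (QPath.trivial b)) α
  refine ⟨boundProj _ y, ?_⟩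
  rw [← hxe, hyt, map_add, map_mul, ← arrowClass, add_eq_left]
  refine eq_zero_of_monomialCoeff hS fun P hP => ?_
  rw [monomialCoeff_boundProj]
  by_cases hPα : ∃ (s : V) (q : Quiver.Path s a), P = ⟨s, b, q.cons α⟩
  · obtain ⟨s, q, rfl⟩ := hPα
    exact ht s q
  · push Not at hPα
    have h := congrArg (coeff P) hyt
    rw [map_add, coeff_mul_arrow_of_ne y α hPα, zero_add] at h
    rw [← h]
    by_contra hne
    obtain ⟨s, t, P⟩ := P
    obtain ⟨a', α', q, hα', h'⟩ := exists_eq_cons_of_coeff_ne_zero hS hxβ hP hne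
    cases huniq a' α' hα'
    exact hPα _ _ h'

theorem eq_zero_of_mul_arrowClass_eq_zero (hS : ∀ p ∈ S, p.length = 2)
    {b c : V} {β : b ⟶ c}
    (hβ : ∀ (a : V) (α : a ⟶ b), QPath.two α β ∉ S)
    {x : BoundQuiverAlgebra (monomialIdeal 𝕜 S)} (hxe : x * vertexIdem _ b = x)
    (hxβ : x * arrowClass _ β = 0) : x = 0 := by
  obtain ⟨x, rfl⟩ := boundProj_surjective _ x
  rw [arrowClass, ← map_mul, boundProj_eq_zero_iff] at hxβ
  rw [vertexIdem, ← map_mul] at hxe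
  rw [← hxe]
  refine eq_zero_of_monomialCoeff hS fun P hP => ?_
  rw [monomialCoeff_boundProj]
  by_contra hne
  obtain ⟨s, t, P⟩ := P
  obtain ⟨a, α, -, h, -⟩ := exists_eq_cons_of_coeff_ne_zero hS hxβ hP hne
  exact hβ a α h

/-- `LeftChain S n β` says that there is a path `αₙ ⋯ α₁ β` all of whose factors of length two lie
in `S`. -/
inductive LeftChain (S : Set (QPath V)) : ℕ → ∀ {a b : V}, (a ⟶ b) → Prop
  | zero {a b : V} (β : a ⟶ b) : LeftChain S 0 β
  | succ {n : ℕ} {a b c : V} {α : a ⟶ b} {β : b ⟶ c} (h : QPath.two α β ∈ S)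
      (hα : LeftChain S n α) : LeftChain S (n + 1) β

/-- Among the arrows `α` ending where an arrow `β` starts, at most one gives a path `αβ` in `S`. -/
def LeftUnique (S : Set (QPath V)) : Prop :=
  ∀ {a a' b c : V} (α : a ⟶ b) (α' : a' ⟶ b) (β : b ⟶ c), QPath.two α β ∈ S →
    QPath.two α' β ∈ S → (⟨a', α'⟩ : Σ a : V, (a ⟶ b)) = ⟨a, α⟩

/-- The next syzygy of `A β` is `A α`, if there is an arrow `α` with `αβ ∈ S`, and `0` otherwise. -/
theorem principalResolution_arrowClass (hS : ∀ p ∈ S, p.length = 2)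
    (hu : LeftUnique S) {n : ℕ} :
    ∀ {a b : V} (β : a ⟶ b), ¬ LeftChain S n β →
      PrincipalResolution n (arrowClass (monomialIdeal 𝕜 S) β) := by
  induction n with
  | zero => exact fun β h => absurd (.zero β) h
  | succ n ih =>
    intro b c β h
    by_cases hα : ∃ (a : V) (α : a ⟶ b), QPath.two α β ∈ S
    · obtain ⟨a, α, hα⟩ := hα
      refine .succ (ih α fun h' => h (.succ hα h')) (isIdempotentElem_vertexIdem _ b)
        (vertexIdem_mul_arrowClass _ β) (arrowClass_mul_vertexIdem _ α) ?_
        fun x => exists_eq_mul_arrowClass hS fun a' α' h' => hu α α' β hα h'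
      rw [arrowClass_mul_arrowClass, boundProj_eq_zero_iff]
      exact TwoSidedIdeal.subset_span ⟨_, hα, rfl⟩
    · push Not at hα
      exact .succ (.zero n) (isIdempotentElem_vertexIdem _ b) (vertexIdem_mul_arrowClass _ β)
        (zero_mul _) (zero_mul _)
        fun x hx hx' => ⟨0, by rw [eq_zero_of_mul_arrowClass_eq_zero hS hα hx hx', zero_mul]⟩

theorem not_hasProjectiveDimensionLT_span_arrowClass (hS : ∀ p ∈ S, p.length = 2)
    (hu : LeftUnique S) {n : ℕ} {a b : V}
    {β : a ⟶ b} (h : LeftChain S n β) :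
    ¬ HasProjectiveDimensionLT
      (ModuleCat.of (BoundQuiverAlgebra (monomialIdeal 𝕜 S))
        (Ideal.span {arrowClass (monomialIdeal 𝕜 S) β})) n := by
  induction h with
  | zero β =>
    rw [hasProjectiveDimensionLT_zero_iff_isZero, ModuleCat.isZero_iff_subsingleton]
    intro h
    have h0 : arrowClass (monomialIdeal 𝕜 S) β = 0 := congrArg Subtype.val
      (h.elim ⟨arrowClass (monomialIdeal 𝕜 S) β, Ideal.mem_span_singleton_self _⟩ 0)
    refine arrowClass_ne_mul_mul (𝕜 := 𝕜) hS β 0 ?_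
    rw [h0, mul_zero]
  | @succ n a b c α β hα _ ih =>
    have h1 : arrowClass (monomialIdeal 𝕜 S) α * vertexIdem _ b ∈ Ideal.span {vertexIdem _ b} :=
      Ideal.mul_mem_left _ _ (Ideal.mem_span_singleton_self _)
    have h2 : vertexIdem _ b * arrowClass (monomialIdeal 𝕜 S) β ∈ Ideal.span {arrowClass _ β} :=
      Ideal.mul_mem_left _ _ (Ideal.mem_span_singleton_self _)
    have hαβ : arrowClass (monomialIdeal 𝕜 S) α * arrowClass _ β = 0 := by
      rw [arrowClass_mul_arrowClass, boundProj_eq_zero_iff]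
      exact TwoSidedIdeal.subset_span ⟨_, hα, rfl⟩
    have he := isIdempotentElem_vertexIdem (monomialIdeal 𝕜 S) b
    have := projective_span_of_isIdempotentElem he
    have hαe := arrowClass_mul_vertexIdem (monomialIdeal 𝕜 S) α
    refine not_hasProjectiveDimensionLT_succ_of_exact
      (spanMulRight_self_injective hαe h1)
      (spanMulRight_surjective (vertexIdem_mul_arrowClass _ β) h2)
      (spanMulRight_exact he hαe hαβ
        (fun x => exists_eq_mul_arrowClass hS fun a' α' h' => hu α α' β hα h') h1 h2) ?_ ih
    exact comp_ne_id_of_ne_mul_mul (arrowClass_ne_mul_mul hS α)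
      (e := ⟨_, Ideal.mem_span_singleton_self _⟩) hαe (spanMulRight_self_apply hαe h1)

theorem le_globalDimension_of_leftChain (hS : ∀ p ∈ S, p.length = 2)
    (hu : LeftUnique S) {n : ℕ} {a b : V}
    {β : a ⟶ b} (h : LeftChain S n β) :
    ((n + 1 : ℕ) : WithBot ℕ∞) ≤ globalDimension (BoundQuiverAlgebra (monomialIdeal 𝕜 S)) := by
  refine le_trans ?_ (le_iSup (fun M : ModuleCat (BoundQuiverAlgebra (monomialIdeal 𝕜 S)) =>
    projectiveDimension M) (ModuleCat.of _ (BoundQuiverAlgebra (monomialIdeal 𝕜 S) ⧸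
      Ideal.span {arrowClass (monomialIdeal 𝕜 S) β})))
  rw [projectiveDimension_ge_iff]
  have := not_hasProjectiveDimensionLT_span_arrowClass (𝕜 := 𝕜) hS hu h
  refine not_hasProjectiveDimensionLT_succ_of_exact (Submodule.injective_subtype _)
    (Submodule.mkQ_surjective _) (LinearMap.exact_subtype_mkQ _) ?_ this
  exact subtype_comp_ne_id_of_ne_mul_mul (arrowClass_ne_mul_mul hS β)

end QuadraticMonomial

/-! ### Resolving modules annihilated by the arrows -/

section SemisimpleModules

open PathAlgebra

variable {𝕜 : Type z} [Field 𝕜] {V : Type u} [Quiver.{w} V] [Finite V]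

/-- Up to a multiple of `e_v`, every element of `A e_v` is an `A`-combination of arrows
ending at `v`. -/
theorem exists_mul_vertexIdem_eq (I : TwoSidedIdeal (PathAlgebra 𝕜 V)) (v : V)
    (x : BoundQuiverAlgebra I) :
    ∃ c : 𝕜, ∃ j ∈ Ideal.span (Set.range fun α : Σ a : V, (a ⟶ v) => arrowClass I α.2),
      x * vertexIdem I v = c • vertexIdem I v + j := by
  classical
  obtain ⟨x, rfl⟩ := boundProj_surjective _ x
  induction x using induction with
  | zero => exact ⟨0, 0, zero_mem _, by simp⟩
  | add x y hx hy =>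
    obtain ⟨c, j, hj, hx⟩ := hx
    obtain ⟨c', j', hj', hy⟩ := hy
    exact ⟨c + c', j + j', add_mem hj hj', by rw [map_add, add_mul, hx, hy, add_smul]; abel⟩
  | smul_of k p =>
    have hp : boundProj I (of p) * vertexIdem I v =
        boundProj I (if p.target = v then of p else 0) := by
      rw [vertexIdem, ← map_mul, mul_of, mulPath_trivial_right]
    rw [map_smul, Algebra.smul_mul_assoc, hp]
    obtain ⟨s, t, p⟩ := p
    split_ifs with h
    · dsimp only at h
      subst h
      cases p with
      | nil => exact ⟨k, 0, zero_mem _, by rw [add_zero]; rfl⟩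
      | cons p α =>
        refine ⟨0, k • boundProj I (of ⟨s, t, p.cons α⟩), ?_, by simp⟩
        rw [boundProj_cons, ← Algebra.smul_mul_assoc]
        exact Ideal.mul_mem_left _ _ (Ideal.subset_span ⟨⟨_, α⟩, rfl⟩)
    · exact ⟨0, 0, zero_mem _, by simp⟩

variable {S : Set (QPath V)}

theorem monomialCoeff_span_arrowClass_of_ne (hS : ∀ p ∈ S, p.length = 2) {P : QPath V}
    (hP : P.path.Avoids S) {a b : V} {α : a ⟶ b}
    (hne : ∀ (s : V) (q : Quiver.Path s a), P ≠ ⟨s, b, q.cons α⟩)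
    {x : BoundQuiverAlgebra (monomialIdeal 𝕜 S)} (hx : x ∈ Ideal.span {arrowClass _ α}) :
    monomialCoeff hS hP x = 0 := by
  obtain ⟨y, rfl⟩ := Ideal.mem_span_singleton'.1 hx
  exact monomialCoeff_mul_arrowClass_of_ne hS hP hne y

section Sum

variable {ι : Type (max u w z)} (v : ι → V)

theorem span_arrowClass_le (I : TwoSidedIdeal (PathAlgebra 𝕜 V)) {a b : V} (α : a ⟶ b) :
    Ideal.span {arrowClass I α} ≤ Ideal.span {vertexIdem I b} := by
  rw [Ideal.span_singleton_le_iff_mem, ← arrowClass_mul_vertexIdem]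
  exact Ideal.mul_mem_left _ _ (Ideal.mem_span_singleton_self _)

open Classical in
/-- The sum of the inclusions `A α → A e_{v i}`, over all `i` and all arrows `α` ending at `v i`. -/
def arrowSumMap (I : TwoSidedIdeal (PathAlgebra 𝕜 V)) :
    (Π₀ j : Σ i : ι, Σ a : V, (a ⟶ v i), Ideal.span {arrowClass I j.2.2})
      →ₗ[BoundQuiverAlgebra I] Π₀ i : ι, Ideal.span {vertexIdem I (v i)} :=
  DFinsupp.lsum ℕ fun j =>
    DFinsupp.lsingle j.1 ∘ₗ Submodule.inclusion (span_arrowClass_le I j.2.2)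

open Classical in
theorem arrowSumMap_single (I : TwoSidedIdeal (PathAlgebra 𝕜 V))
    (j : Σ i : ι, Σ a : V, (a ⟶ v i)) (x : Ideal.span {arrowClass I j.2.2}) :
    arrowSumMap v I (DFinsupp.single j x) =
      DFinsupp.single j.1 ⟨x, span_arrowClass_le I j.2.2 x.2⟩ := by
  simp only [arrowSumMap, DFinsupp.lsum_single]
  rfl

theorem arrowSumMap_injective (hS : ∀ p ∈ S, p.length = 2) :
    Function.Injective (arrowSumMap v (monomialIdeal 𝕜 S)) := by
  classical
  rw [injective_iff_map_eq_zero]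
  intro x hx
  ext j
  refine eq_zero_of_monomialCoeff hS fun P hP => ?_
  by_cases hPj : ∃ (s : V) (q : Quiver.Path s j.2.1), P = ⟨s, v j.1, q.cons j.2.2⟩
  · -- At a path that ends with the arrow `j`, only the `j`-th summand contributes.
    have key : ∀ x, monomialCoeff hS hP (arrowSumMap v (monomialIdeal 𝕜 S) x j.1) =
        monomialCoeff hS hP (x j : BoundQuiverAlgebra (monomialIdeal 𝕜 S)) := by
      intro x
      induction x using DFinsupp.induction with
      | h0 => simp
      | ha j' y x _ _ ih =>
        rw [map_add, DFinsupp.add_apply, DFinsupp.add_apply, Submodule.coe_add, Submodule.coe_add,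
          map_add, map_add, ih, arrowSumMap_single]
        congr 1
        by_cases hj : j' = j
        · subst hj
          rw [DFinsupp.single_eq_same, DFinsupp.single_eq_same]
        · rw [DFinsupp.single_eq_of_ne (Ne.symm hj)]
          obtain ⟨i, a, α⟩ := j
          obtain ⟨i', a', α'⟩ := j'
          by_cases hi : i' = i
          · subst hi
            rw [DFinsupp.single_eq_same, ZeroMemClass.coe_zero, map_zero]
            refine monomialCoeff_span_arrowClass_of_ne hS hP (α := α') ?_ y.2
            rintro s q h
            obtain ⟨s', q', h'⟩ := hPj
            rw [h] at h'
            cases h'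
            exact hj rfl
          · rw [DFinsupp.single_eq_of_ne (Ne.symm hi)]
            rfl
    rw [← key, hx]
    simp
  · push Not at hPj
    exact monomialCoeff_span_arrowClass_of_ne hS hP hPj (x j).2

variable {N : Type (max u w z)} [AddCommGroup N]

open Classical in
/-- The map `⨁ A e_{v i} → N` that sends `e_{v i}` to `b i`, if `b i ∈ e_{v i} N`. -/
def vertexSumMap (I : TwoSidedIdeal (PathAlgebra 𝕜 V)) [Module (BoundQuiverAlgebra I) N]
    (b : ι → N) :
    (Π₀ i : ι, Ideal.span {vertexIdem I (v i)}) →ₗ[BoundQuiverAlgebra I] N :=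
  DFinsupp.lsum ℕ fun i =>
    LinearMap.toSpanSingleton (BoundQuiverAlgebra I) N (b i) ∘ₗ Submodule.subtype _

open Classical in
theorem vertexSumMap_single (I : TwoSidedIdeal (PathAlgebra 𝕜 V)) [Module (BoundQuiverAlgebra I) N]
    (b : ι → N) (i : ι) (x : Ideal.span {vertexIdem I (v i)}) :
    vertexSumMap v I b (DFinsupp.single i x) = (x : BoundQuiverAlgebra I) • b i := by
  simp only [vertexSumMap, DFinsupp.lsum_single]
  rfl

open Classical in
theorem exists_eq_arrowSumMap_add (I : TwoSidedIdeal (PathAlgebra 𝕜 V))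
    (x : Π₀ i : ι, Ideal.span {vertexIdem I (v i)}) :
    ∃ k, ∃ c : ι →₀ 𝕜, x = arrowSumMap v I k +
      c.sum fun i t => DFinsupp.single i (t • ⟨vertexIdem I (v i),
        Ideal.mem_span_singleton_self _⟩ : Ideal.span {vertexIdem I (v i)}) := by
  induction x using DFinsupp.induction with
  | h0 => exact ⟨0, 0, by simp⟩
  | ha i y x _ _ ih =>
    obtain ⟨k, c, rfl⟩ := ih
    obtain ⟨t, j, hj, hy⟩ := exists_mul_vertexIdem_eq I (v i) (y : BoundQuiverAlgebra I)
    rw [mem_span_idempotent (isIdempotentElem_vertexIdem I _) y.2] at hy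
    have hle : Ideal.span (Set.range fun α : Σ a : V, (a ⟶ v i) => arrowClass I α.2) ≤
        ((LinearMap.range (arrowSumMap v I)).comap
          (DFinsupp.lsingle i : _ →ₗ[BoundQuiverAlgebra I] _)).map
            (Submodule.subtype (Ideal.span {vertexIdem I (v i)})) := by
      rw [Ideal.span, Submodule.span_le]
      rintro _ ⟨α, rfl⟩
      exact ⟨⟨arrowClass I α.2, span_arrowClass_le I α.2 (Ideal.mem_span_singleton_self _)⟩,
        ⟨DFinsupp.single ⟨i, α⟩ ⟨arrowClass I α.2, Ideal.mem_span_singleton_self _⟩,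
          arrowSumMap_single v I _ _⟩, rfl⟩
    obtain ⟨j, ⟨k', hk'⟩, rfl⟩ := hle hj
    have hy' : y = t • ⟨vertexIdem I (v i), Ideal.mem_span_singleton_self _⟩ + j := Subtype.ext hy
    refine ⟨k + k', c + Finsupp.single i t, ?_⟩
    rw [Finsupp.sum_add_index' (by simp) (by intros; rw [add_smul, DFinsupp.single_add]),
      Finsupp.sum_single_index (by simp), map_add, hk', hy', DFinsupp.single_add]
    simp only [DFinsupp.lsingle_apply]
    abel

theorem vertexSumMap_arrowSumMap {I : TwoSidedIdeal (PathAlgebra 𝕜 V)}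
    [Module (BoundQuiverAlgebra I) N] (b : ι → N)
    (hN : ∀ {a b : V} (α : a ⟶ b) (m : N), arrowClass I α • m = 0)
    (k : Π₀ j : Σ i : ι, Σ a : V, (a ⟶ v i), Ideal.span {arrowClass I j.2.2}) :
    vertexSumMap v I b (arrowSumMap v I k) = 0 := by
  classical
  induction k using DFinsupp.induction with
  | h0 => simp
  | ha j y x _ _ ih =>
    rw [map_add, map_add, ih, add_zero, arrowSumMap_single, vertexSumMap_single]
    obtain ⟨t, ht⟩ := Ideal.mem_span_singleton'.1 y.2
    rw [← ht, mul_smul, hN, smul_zero]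

variable {I : TwoSidedIdeal (PathAlgebra 𝕜 V)} [Module (BoundQuiverAlgebra I) N] [Module 𝕜 N]
  [IsScalarTower 𝕜 (BoundQuiverAlgebra I) N] {v}

theorem vertexSumMap_surjective {b : ι → N} (hv : ∀ i, vertexIdem I (v i) • b i = b i)
    (hb : Submodule.span 𝕜 (Set.range b) = ⊤) : Function.Surjective (vertexSumMap v I b) := by
  classical
  have h : Submodule.span 𝕜 (Set.range b) ≤
      (LinearMap.range (vertexSumMap v I b)).restrictScalars 𝕜 := by
    rw [Submodule.span_le]
    rintro _ ⟨i, rfl⟩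
    exact ⟨DFinsupp.single i ⟨_, Ideal.mem_span_singleton_self _⟩,
      (vertexSumMap_single v I b i _).trans (hv i)⟩
  exact fun m => h (hb ▸ Submodule.mem_top)

theorem exact_arrowSumMap_vertexSumMap {b : ι → N}
    (hN : ∀ {a b : V} (α : a ⟶ b) (m : N), arrowClass I α • m = 0)
    (hv : ∀ i, vertexIdem I (v i) • b i = b i) (hb : LinearIndependent 𝕜 b) :
    Function.Exact (arrowSumMap v I) (vertexSumMap v I b) := by
  classical
  intro x
  constructor
  · intro hx
    obtain ⟨k, c, rfl⟩ := exists_eq_arrowSumMap_add v I x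
    rw [map_add, vertexSumMap_arrowSumMap v b hN, zero_add, Finsupp.sum, map_sum] at hx
    have hc : c = 0 := by
      refine (linearIndependent_iff.1 hb) c ?_
      rw [Finsupp.linearCombination_apply, ← hx]
      refine Finset.sum_congr rfl fun i _ => ?_
      rw [vertexSumMap_single]
      change c i • b i = (c i • vertexIdem I (v i)) • b i
      rw [smul_assoc, hv]
    exact ⟨k, by simp [hc]⟩
  · rintro ⟨k, rfl⟩
    exact vertexSumMap_arrowSumMap v b hN k

end Sum

/-- A module annihilated by all arrows has projective dimension at most `n` if the left ideals
generated by the arrows have principal resolutions of length `< n`: such a module is a direct sum of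
simple modules `A e_v / rad (A e_v)`, and `rad (A e_v)` is the direct sum of the left ideals `A α`,
for the arrows `α` ending at `v`. -/
theorem hasProjectiveDimensionLT_of_arrowClass_smul (hS : ∀ p ∈ S, p.length = 2) {n : ℕ}
    (hres : ∀ {a b : V} (α : a ⟶ b), PrincipalResolution n (arrowClass (monomialIdeal 𝕜 S) α))
    {N : Type (max u w z)} [AddCommGroup N] [Module (BoundQuiverAlgebra (monomialIdeal 𝕜 S)) N]
    (hN : ∀ {a b : V} (α : a ⟶ b) (m : N), arrowClass (monomialIdeal 𝕜 S) α • m = 0) :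
    HasProjectiveDimensionLT (ModuleCat.of (BoundQuiverAlgebra (monomialIdeal 𝕜 S)) N)
      (n + 1) := by
  let _ := Fintype.ofFinite V
  let A := BoundQuiverAlgebra (monomialIdeal 𝕜 S)
  let _ : Module 𝕜 N := Module.compHom N (algebraMap 𝕜 A)
  have : IsScalarTower 𝕜 A N := ⟨fun c x m => by
    rw [Algebra.smul_def, mul_smul]
    rfl⟩
  -- A basis of `N` over the ground field that consists of elements of the subspaces `e_v N`.
  obtain ⟨B, hBs, hBspan, hB⟩ := exists_linearIndependent 𝕜
    {m : N | ∃ v : V, vertexIdem (monomialIdeal 𝕜 S) v • m = m}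
  choose v hv using fun i : B => hBs i.2
  have hspan : Submodule.span 𝕜 (Set.range (Subtype.val : B → N)) = ⊤ := by
    rw [Subtype.range_coe, hBspan, eq_top_iff]
    intro m _
    rw [← one_smul A m, ← sum_vertexIdem, Finset.sum_smul]
    refine Submodule.sum_mem _ fun v _ => Submodule.subset_span ⟨v, ?_⟩
    rw [← mul_smul, (isIdempotentElem_vertexIdem _ v).eq]
  have hinj := arrowSumMap_injective (𝕜 := 𝕜) v hS
  have hsurj := vertexSumMap_surjective hv hspan
  have hex := exact_arrowSumMap_vertexSumMap hN hv hB
  exact hasProjectiveDimensionLT_succ_of_exact_dfinsupp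
    (c := fun j : Σ i : B, Σ a : V, (a ⟶ v i) => arrowClass (monomialIdeal 𝕜 S) j.2.2)
    (e := fun i => vertexIdem (monomialIdeal 𝕜 S) (v i))
    (fun j => hres j.2.2) (fun i => isIdempotentElem_vertexIdem _ (v i)) hinj hsurj hex

/-- By induction along the radical filtration, the bound for modules annihilated by the arrows
extends to all modules annihilated by the paths of some length. -/
theorem hasProjectiveDimensionLT_of_length_smul (hS : ∀ p ∈ S, p.length = 2) {n : ℕ}
    (hres : ∀ {a b : V} (α : a ⟶ b), PrincipalResolution n (arrowClass (monomialIdeal 𝕜 S) α))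
    (k : ℕ) : ∀ {M : Type (max u w z)} [AddCommGroup M]
      [Module (BoundQuiverAlgebra (monomialIdeal 𝕜 S)) M],
      (∀ (p : QPath V) (m : M), k ≤ p.length → boundProj (monomialIdeal 𝕜 S) (of p) • m = 0) →
      HasProjectiveDimensionLT (ModuleCat.of (BoundQuiverAlgebra (monomialIdeal 𝕜 S)) M)
        (n + 1) := by
  induction k with
  | zero =>
    exact fun hM => hasProjectiveDimensionLT_of_arrowClass_smul hS hres
      fun α m => hM _ m (Nat.zero_le _)
  | succ k ih =>
    intro M _ _ hM
    let M' : Submodule (BoundQuiverAlgebra (monomialIdeal 𝕜 S)) M := Submodule.span _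
      {y | ∃ (a b : V) (α : a ⟶ b) (m : M), y = arrowClass (monomialIdeal 𝕜 S) α • m}
    have hM' : ∀ y ∈ M', ∀ (p : QPath V), k ≤ p.length →
        boundProj (monomialIdeal 𝕜 S) (of p) • y = 0 := by
      intro y hy
      induction hy using Submodule.span_induction with
      | zero => simp
      | add y y' _ _ hy hy' => exact fun p hp => by rw [smul_add, hy p hp, hy' p hp, add_zero]
      | mem y hy =>
        obtain ⟨a, b, α, m, rfl⟩ := hy
        rintro ⟨s, t, p⟩ hp
        rw [← mul_smul]
        by_cases h : t = a
        · subst h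
          rw [← boundProj_cons]
          exact hM _ m (Nat.succ_le_succ hp)
        · rw [arrowClass, ← map_mul, mul_of, mulPath_eq_zero (q := QPath.arrow α) h, map_zero,
            zero_smul]
      | smul x y _ hy =>
        intro p hp
        obtain ⟨x, rfl⟩ := boundProj_surjective _ x
        rw [← mul_smul, ← map_mul]
        induction x using induction with
        | zero => simp
        | add x x' hx hx' => rw [mul_add, map_add, add_smul, hx, hx', add_zero]
        | smul_of c q =>
          rw [Algebra.mul_smul_comm, map_smul, mul_of, Algebra.smul_def, mul_smul]
          by_cases h : p.target = q.source
          · rw [mulPath_eq_of h, hy, smul_zero]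
            obtain ⟨a, b, p⟩ := p
            obtain ⟨c, d, q⟩ := q
            dsimp only at h
            subst h
            refine hp.trans ?_
            simp [QPath.comp, QPath.length]
          · rw [mulPath_eq_zero h, map_zero, zero_smul, smul_zero]
    have hS' := ModuleCat.shortComplex_shortExact
      (ModuleCat.shortComplexOfCompEqZero M'.subtype M'.mkQ
        (LinearMap.exact_subtype_mkQ M').linearMap_comp_eq_zero)
      (LinearMap.exact_subtype_mkQ M') (Submodule.injective_subtype _)
      (Submodule.mkQ_surjective _)
    refine hS'.hasProjectiveDimensionLT_X₂ (n + 1) (ih fun p m hp => Subtype.ext (hM' m m.2 p hp))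
      (hasProjectiveDimensionLT_of_arrowClass_smul hS hres fun α m => ?_)
    obtain ⟨m, rfl⟩ := Submodule.mkQ_surjective _ m
    rw [← map_smul, Submodule.mkQ_apply, Submodule.Quotient.mk_eq_zero]
    exact Submodule.subset_span ⟨_, _, α, m, rfl⟩

theorem globalDimension_le (hS : ∀ p ∈ S, p.length = 2) (hu : LeftUnique S)
    (hfin : Module.Finite 𝕜 (BoundQuiverAlgebra (monomialIdeal 𝕜 S))) {n : ℕ}
    (hn : ∀ {a b : V} (β : a ⟶ b), ¬ LeftChain S n β) :
    globalDimension (BoundQuiverAlgebra (monomialIdeal 𝕜 S)) ≤ n := by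
  obtain ⟨N, hN⟩ := exists_forall_length_boundProj_eq_zero hS hfin
  refine iSup_le fun M => (projectiveDimension_le_iff M n).2 ?_
  exact hasProjectiveDimensionLT_of_length_smul hS
    (fun α => principalResolution_arrowClass hS hu α (hn α)) N
    fun p m hp => by rw [hN p hp, zero_smul]

theorem zero_le_globalDimension (hS : ∀ p ∈ S, p.length = 2) [Nonempty V] :
    0 ≤ globalDimension (BoundQuiverAlgebra (monomialIdeal 𝕜 S)) := by
  let A := BoundQuiverAlgebra (monomialIdeal 𝕜 S)
  refine le_trans ?_ (le_iSup (fun M : ModuleCat A => projectiveDimension M) (ModuleCat.of A A))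
  refine (projectiveDimension_ge_iff _ 0).2 ?_
  rw [hasProjectiveDimensionLT_zero_iff_isZero, ModuleCat.isZero_iff_subsingleton]
  intro h
  obtain ⟨v⟩ := ‹Nonempty V›
  have h0 : vertexIdem (monomialIdeal 𝕜 S) v = 0 := h.elim (α := A) _ _
  have hP : (QPath.trivial v).path.Avoids S := Quiver.Path.avoids_nil v
  have := congrArg (monomialCoeff hS hP) h0
  rw [vertexIdem, monomialCoeff_boundProj, coeff_of_self, map_zero] at this
  exact one_ne_zero this

end SemisimpleModules

/-! ### Permitted threads of the Koszul dual -/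

section Threads

open PathAlgebra

variable {V : Type u} [Quiver.{w} V]

/-- The relations of length two of the Koszul dual: the reversed paths `α^! β^!` for which `βα` is
not a relation. -/
def dualRelations (S : Set (QPath V)) : Set (QPath Vᵒᵖ) :=
  {p | ∃ (a b c : V) (β : a ⟶ b) (α : b ⟶ c), QPath.two β α ∉ S ∧ p = QPath.two α.op β.op}

variable {S : Set (QPath V)}

theorem length_of_mem_dualRelations {p : QPath Vᵒᵖ} (hp : p ∈ dualRelations S) : p.length = 2 := by
  obtain ⟨a, b, c, β, α, -, rfl⟩ := hp
  rfl

theorem two_op_mem_dualRelations {a b c : V} {β : a ⟶ b} {α : b ⟶ c} :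
    QPath.two α.op β.op ∈ dualRelations S ↔ QPath.two β α ∉ S := by
  refine ⟨?_, fun h => ⟨a, b, c, β, α, h, rfl⟩⟩
  rintro ⟨a', b', c', β', α', h, e⟩
  cases e
  exact h

theorem exists_avoids_of_leftChain {n : ℕ} {a b : V} {β : a ⟶ b} (h : LeftChain S n β) :
    ∃ (x : Vᵒᵖ) (q : Quiver.Path (Opposite.op a) x), q.length = n ∧
      (β.op.toPath.comp q).Avoids (dualRelations S) := by
  induction h with
  | zero β => exact ⟨_, .nil, rfl, Quiver.Path.avoids_nil_cons _⟩
  | @succ n a b c α β hαβ _ ih =>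
    obtain ⟨x, q, hq, h⟩ := ih
    refine ⟨x, α.op.toPath.comp q, by simp [hq, add_comm], ?_⟩
    rw [Quiver.Path.avoids_toPath_comp_toPath_comp, two_op_mem_dualRelations]
    exact ⟨not_not.2 hαβ, h⟩

theorem leftChain_of_avoids {n : ℕ} : ∀ {a b : V} {β : a ⟶ b} {x : Vᵒᵖ}
    {q : Quiver.Path (Opposite.op a) x}, q.length = n →
      (β.op.toPath.comp q).Avoids (dualRelations S) → LeftChain S n β := by
  induction n with
  | zero => exact fun _ _ => .zero _
  | succ n ih =>
    intro a b β x q hq h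
    obtain ⟨y, α, q, hq', rfl⟩ := q.eq_toPath_comp_of_length_eq_succ hq
    have h' := Quiver.Path.avoids_toPath_comp_toPath_comp.1 h
    exact .succ (not_not.1 fun hαβ => h'.1 (two_op_mem_dualRelations.2 hαβ))
      (ih (a := y.unop) (β := α.unop) hq' h'.2)

theorem exists_leftChain_of_avoids {n : ℕ} {x y : Vᵒᵖ} {p : Quiver.Path x y}
    (hn : p.length = n + 1) (hp : p.Avoids (dualRelations S)) :
    ∃ (a b : V) (β : a ⟶ b), LeftChain S n β := by
  obtain ⟨y, α, q, hq, rfl⟩ := p.eq_toPath_comp_of_length_eq_succ hn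
  exact ⟨_, _, α.unop, leftChain_of_avoids (a := y.unop) (β := α.unop) hq hp⟩

theorem LeftChain.mono {n m : ℕ} (hnm : n ≤ m) {a b : V} {β : a ⟶ b} (h : LeftChain S m β) :
    LeftChain S n β := by
  induction h generalizing n with
  | zero β =>
    obtain rfl : n = 0 := by lia
    exact .zero β
  | succ hαβ _ ih =>
    cases n with
    | zero => exact .zero _
    | succ n => exact .succ hαβ (ih (by lia))

variable {𝕜 : Type z} [Field 𝕜] [Finite V]

theorem koszulDualIdeal_monomialIdeal (hS : ∀ p ∈ S, p.length = 2) :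
    koszulDualIdeal (monomialIdeal 𝕜 S) = monomialIdeal 𝕜 (dualRelations S) := by
  rw [koszulDualIdeal, monomialIdeal, monomialIdeal]
  congr 1
  ext x
  constructor
  · rintro ⟨a, b, c, β, α, h, rfl⟩
    exact ⟨_, ⟨a, b, c, β, α, fun h' => h ((twoPath_mem_span_iff hS).2 h'), rfl⟩, rfl⟩
  · rintro ⟨_, ⟨a, b, c, β, α, h, rfl⟩, rfl⟩
    exact ⟨a, b, c, β, α, fun h' => h ((twoPath_mem_span_iff hS).1 h'), rfl⟩

theorem twoPath_mem_koszulDualIdeal_iff (hS : ∀ p ∈ S, p.length = 2) {x y t : Vᵒᵖ} {γ : x ⟶ y}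
    {δ : y ⟶ t} :
    (twoPath γ δ : PathAlgebra 𝕜 Vᵒᵖ) ∈ koszulDualIdeal (monomialIdeal 𝕜 S) ↔
      QPath.two γ δ ∈ dualRelations S := by
  rw [koszulDualIdeal_monomialIdeal hS]
  exact twoPath_mem_span_iff fun p => length_of_mem_dualRelations

theorem IsPermittedThread.avoids (hS : ∀ p ∈ S, p.length = 2) {P : QPath Vᵒᵖ}
    (hP : IsPermittedThread (koszulDualIdeal (monomialIdeal 𝕜 S)) P) :
    P.path.Avoids (dualRelations S) :=
  fun _ _ _ p' α β q h h' => hP.consecutive p' α β q (QPath.ext rfl rfl (heq_of_eq h))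
    ((twoPath_mem_koszulDualIdeal_iff hS).2 h')

/-- A longest path among the paths without factors in `dualRelations S` is a permitted thread. -/
theorem exists_permittedThread_of_leftChain (hS : ∀ p ∈ S, p.length = 2) {n : ℕ}
    (hn : ∀ {a b : V} (β : a ⟶ b), ¬ LeftChain S (n + 1) β) {a b : V} {β : a ⟶ b}
    (h : LeftChain S n β) :
    ∃ P : DualPermittedThread (monomialIdeal 𝕜 S), P.1.length = n + 1 := by
  obtain ⟨P, hlen, ha⟩ : ∃ P : QPath Vᵒᵖ, P.length = n + 1 ∧ P.path.Avoids (dualRelations S) := by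
    obtain ⟨x, q, hq, ha⟩ := exists_avoids_of_leftChain h
    exact ⟨⟨_, x, β.op.toPath.comp q⟩, by simp [QPath.length, hq, add_comm], ha⟩
  refine ⟨⟨P, ⟨?_, ?_, ?_, ?_⟩⟩, hlen⟩
  · rintro a b c d e p γ δ r rfl hI
    exact ha p γ δ r rfl ((twoPath_mem_koszulDualIdeal_iff hS).1 hI)
  · rintro a b c d p γ δ rfl
    rw [twoPath_mem_koszulDualIdeal_iff hS]
    by_contra hγδ
    obtain ⟨_, _, β', h'⟩ := exists_leftChain_of_avoids (n := n + 1)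
      (p := (p.cons γ).cons δ) (congrArg (· + 1) hlen)
      (Quiver.Path.avoids_cons_cons.2 ⟨ha, hγδ⟩)
    exact hn β' h'
  · rintro a b c d γ δ r rfl
    rw [twoPath_mem_koszulDualIdeal_iff hS]
    by_contra hγδ
    obtain ⟨_, _, β', h'⟩ := exists_leftChain_of_avoids (n := n + 1)
      (p := γ.toPath.comp (δ.toPath.comp r))
      (by rw [Quiver.Path.length_comp, Quiver.Path.length_toPath, add_comm]
          exact congrArg (· + 1) hlen)
      (Quiver.Path.avoids_toPath_comp_toPath_comp.2 ⟨hγδ, ha⟩)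
    exact hn β' h'
  · rintro v rfl
    exact absurd hlen (Nat.succ_ne_zero n).symm

theorem exists_permittedThread_of_isEmpty [Nonempty V]
    (hV : ∀ a b : V, IsEmpty (a ⟶ b)) :
    ∃ P : DualPermittedThread (monomialIdeal 𝕜 S), P.1.length = 0 := by
  obtain ⟨v⟩ := ‹Nonempty V›
  suffices h : IsPermittedThread (koszulDualIdeal (monomialIdeal 𝕜 S))
      (QPath.trivial (Opposite.op v)) from ⟨⟨_, h⟩, Quiver.Path.length_nil⟩
  refine ⟨?_, ?_, ?_, ?_⟩
  · intro a b c d e p γ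
    exact ((hV _ _).false γ.unop).elim
  · intro a b c d p γ
    exact ((hV _ _).false γ.unop).elim
  · intro a b c d γ
    exact ((hV _ _).false γ.unop).elim
  · intro v' _ b
    exact ⟨⟨fun γ => (hV _ _).false γ.unop⟩, ⟨fun γ => (hV _ _).false γ.unop⟩⟩

/-- The global dimension is the greatest length of a permitted thread of the Koszul dual. -/
theorem exists_globalDimension_eq_isGreatest [Nonempty V] (hS : ∀ p ∈ S, p.length = 2)
    (hu : LeftUnique S) (hfin : Module.Finite 𝕜 (BoundQuiverAlgebra (monomialIdeal 𝕜 S)))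
    (hgl : globalDimension (BoundQuiverAlgebra (monomialIdeal 𝕜 S)) < ⊤) :
    ∃ n : ℕ, globalDimension (BoundQuiverAlgebra (monomialIdeal 𝕜 S)) = n ∧
      IsGreatest (Set.range fun P : DualPermittedThread (monomialIdeal 𝕜 S) => P.1.length) n := by
  classical
  have hex : ∃ n, ∀ (a b : V) (β : a ⟶ b), ¬ LeftChain S n β := by
    by_contra! h
    refine hgl.ne (ENat.WithBot.eq_top_iff_forall_ge.2 fun n => ?_)
    obtain ⟨a, b, β, hβ⟩ := h n
    exact le_trans (by exact_mod_cast n.le_succ) (le_globalDimension_of_leftChain hS hu hβ)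
  -- The least such `n` is one more than the greatest `m` for which a chain `αₘ ⋯ α₁ β` exists, that
  -- is, the number of arrows of a longest chain; it is `0` if there are no arrows.
  let n := Nat.find hex
  have hn : ∀ {a b : V} (β : a ⟶ b), ¬ LeftChain S n β := fun β => Nat.find_spec hex _ _ β
  have hmin : ∀ m < n, ∃ (a b : V) (β : a ⟶ b), LeftChain S m β := fun m hm => by
    simpa using Nat.find_min hex hm
  refine ⟨n, le_antisymm (globalDimension_le hS hu hfin hn) ?_, ?_, ?_⟩
  · rcases Nat.eq_zero_or_eq_succ_pred n with h0 | h0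
    · rw [h0]
      exact zero_le_globalDimension hS
    · obtain ⟨a, b, β, hβ⟩ := hmin (n - 1) (by lia)
      rw [h0]
      exact le_globalDimension_of_leftChain hS hu hβ
  · rcases Nat.eq_zero_or_eq_succ_pred n with h0 | h0
    · rw [h0]
      exact exists_permittedThread_of_isEmpty fun a b =>
        ⟨fun β => hn β (h0 ▸ .zero β)⟩
    · obtain ⟨a, b, β, hβ⟩ := hmin (n - 1) (by lia)
      rw [h0] at hn ⊢
      exact exists_permittedThread_of_leftChain hS hn hβ
  · rintro _ ⟨⟨P, hP⟩, rfl⟩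
    by_contra hlt
    rw [not_le] at hlt
    obtain ⟨a, b, β, hβ⟩ := exists_leftChain_of_avoids (n := P.length - 1)
      (by change P.length = _; lia) (hP.avoids hS)
    exact hn β (hβ.mono (by dsimp only at hlt; lia))

end Threads

/-! ### The logarithmic Lebesgue–Stieltjes measures -/

section LogMeasure

/-- The function `t ↦ ln tˡ` for `t ≥ 1`, continued by zero to the left. -/
def logStieltjes (l : ℕ) : StieltjesFunction ℝ where
  toFun t := l * Real.log (max t 1)
  mono' s t hst := by
    have : (0 : ℝ) < max s 1 := lt_max_of_lt_right one_pos
    exact mul_le_mul_of_nonneg_left (Real.log_le_log this (max_le_max_right 1 hst))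
      l.cast_nonneg
  right_continuous' t := by
    have : ∀ s : ℝ, max s 1 ≠ 0 := fun s => (lt_max_of_lt_right one_pos).ne'
    exact ContinuousAt.continuousWithinAt (by fun_prop (disch := exact this _))

theorem logStieltjes_apply (l : ℕ) (t : ℝ) : logStieltjes l t = l * Real.log (max t 1) := rfl

theorem logStieltjes_eq_log_pow (l : ℕ) {t : ℝ} (ht : 1 ≤ t) :
    logStieltjes l t = Real.log (t ^ l) := by
  rw [logStieltjes_apply, max_eq_left ht, Real.log_pow]

theorem logStieltjes_measure_Icc (l : ℕ) {t : ℝ} (ht : 1 ≤ t) :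
    (logStieltjes l).measure (Set.Icc 1 t) = ENNReal.ofReal (Real.log (t ^ l)) := by
  have hc : ContinuousAt (logStieltjes l) 1 := by
    have : ∀ s : ℝ, max s 1 ≠ 0 := fun s => (lt_max_of_lt_right one_pos).ne'
    change ContinuousAt (fun t : ℝ => l * Real.log (max t 1)) 1
    fun_prop (disch := exact this _)
  rw [StieltjesFunction.measure_Icc, hc.continuousWithinAt.leftLim_eq, logStieltjes_eq_log_pow l ht,
    logStieltjes_eq_log_pow l le_rfl]
  simp

/-- On `[1, 2]` the measure of `ln tˡ` has the density `l / t`. -/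
theorem logStieltjes_measure_restrict (l : ℕ) :
    (logStieltjes l).measure.restrict (Set.Icc 1 2) =
      (volume.restrict (Set.Icc (1 : ℝ) 2)).withDensity fun x => ENNReal.ofReal (l / x) := by
  have hfin : IsFiniteMeasure ((logStieltjes l).measure.restrict (Set.Icc 1 2)) :=
    ⟨by simp⟩
  refine Measure.ext_of_Iic _ _ fun t => ?_
  rw [Measure.restrict_apply measurableSet_Iic, withDensity_apply _ measurableSet_Iic,
    Measure.restrict_restrict measurableSet_Iic]
  have hset : Set.Iic t ∩ Set.Icc (1 : ℝ) 2 = Set.Icc 1 (min t 2) := by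
    ext x
    simp only [Set.mem_inter_iff, Set.mem_Iic, Set.mem_Icc, le_min_iff]
    tauto
  rw [hset]
  rcases lt_or_ge (min t 2) 1 with h | h
  · simp [Set.Icc_eq_empty h.not_ge]
  · rw [logStieltjes_measure_Icc l h]
    have hcont : ContinuousOn (fun x : ℝ => (l : ℝ) / x) (Set.Icc 1 (min t 2)) :=
      continuousOn_const.div continuousOn_id fun x hx => (one_pos.trans_le hx.1).ne'
    rw [← ofReal_integral_eq_lintegral_ofReal (hcont.integrableOn_Icc)]
    · rw [integral_Icc_eq_integral_Ioc, ← intervalIntegral.integral_of_le h]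
      simp only [div_eq_mul_inv, intervalIntegral.integral_const_mul]
      rw [integral_inv_of_pos one_pos (one_pos.trans_le h), Real.log_pow, div_one]
    · filter_upwards [ae_restrict_mem measurableSet_Icc] with x hx
      have := one_pos.trans_le hx.1
      simp only [Pi.zero_apply]
      positivity

theorem integrableOn_id_logStieltjes (l : ℕ) :
    IntegrableOn (fun x : ℝ => x) (Set.Icc 1 2) (logStieltjes l).measure :=
  continuousOn_id.integrableOn_Icc

theorem setIntegral_id_logStieltjes (l : ℕ) :
    ∫ x in Set.Icc (1 : ℝ) 2, x ∂(logStieltjes l).measure = l := by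
  rw [logStieltjes_measure_restrict, integral_withDensity_eq_integral_toReal_smul (by fun_prop)
    (by simp)]
  have h : ∀ x ∈ Set.Icc (1 : ℝ) 2, (ENNReal.ofReal (l / x)).toReal • x = l := by
    intro x hx
    have := one_pos.trans_le hx.1
    rw [ENNReal.toReal_ofReal (by positivity), smul_eq_mul, div_mul_cancel₀ _ this.ne']
  rw [setIntegral_congr_fun measurableSet_Icc h]
  simp
  norm_num

/-- The measure of `ln tˡ` as a measure on the interval `[1, 2]`. -/
def logMeasure (l : ℕ) : Measure (Set.Icc (1 : ℝ) 2) :=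
  (logStieltjes l).measure.comap Subtype.val

theorem logMeasure_Iic (l : ℕ) (t : Set.Icc (1 : ℝ) 2) :
    logMeasure l (Set.Iic t) = ENNReal.ofReal (Real.log ((t : ℝ) ^ l)) := by
  rw [logMeasure, (MeasurableEmbedding.subtype_coe measurableSet_Icc).comap_apply,
    ← logStieltjes_measure_Icc l t.2.1]
  congr 1
  ext x
  constructor
  · rintro ⟨y, hy, rfl⟩
    exact ⟨y.2.1, hy⟩
  · exact fun hx => ⟨⟨x, hx.1, hx.2.trans t.2.2⟩, hx.2, rfl⟩

variable {𝕜 : Type z} [RCLike 𝕜]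

theorem integrable_ofReal_logMeasure (l : ℕ) :
    Integrable (fun x : Set.Icc (1 : ℝ) 2 => ((x : ℝ) : 𝕜)) (logMeasure l) := by
  have h : Integrable (fun x : Set.Icc (1 : ℝ) 2 => (x : ℝ)) (logMeasure l) := by
    have := integrableOn_id_logStieltjes l
    rwa [IntegrableOn, ← map_comap_subtype_coe measurableSet_Icc,
      (MeasurableEmbedding.subtype_coe measurableSet_Icc).integrable_map_iff] at this
  exact h.ofReal

theorem integral_ofReal_logMeasure (l : ℕ) :
    ∫ x : Set.Icc (1 : ℝ) 2, ((x : ℝ) : 𝕜) ∂(logMeasure l) = ((l : ℝ) : 𝕜) := by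
  rw [integral_ofReal, logMeasure, integral_subtype_comap measurableSet_Icc fun x : ℝ => x,
    setIntegral_id_logStieltjes]

end LogMeasure

end

theorem theorem5p3 {𝕜 : Type z} [RCLike 𝕜] {V : Type u} [Quiver.{w} V] [Finite V] [Nonempty V]
    (I : TwoSidedIdeal (PathAlgebra 𝕜 V)) (hgentle : IsGentlePair I)
    (hfin : Module.Finite 𝕜 (BoundQuiverAlgebra I))
    (hgl : globalDimension (BoundQuiverAlgebra I) < ⊤) :
    ∃ φ : dualThreadLengths I → Measure (Set.Icc (1 : ℝ) 2),
      (∀ l : dualThreadLengths I,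
        (∃ F : StieltjesFunction ℝ, (∀ t ∈ Set.Icc (1 : ℝ) 2, F t = Real.log (t ^ (l : ℕ))) ∧
          φ l = F.measure.comap Subtype.val) ∧
        ∀ t : Set.Icc (1 : ℝ) 2, φ l (Set.Iic t) = ENNReal.ofReal (Real.log ((t : ℝ) ^ (l : ℕ)))) ∧
      (∀ P : DualPermittedThread I,
        Integrable (fun x : Set.Icc (1 : ℝ) 2 => threadFunctionalOnLine P.2 ((x : ℝ) : 𝕜))
          (φ (DualPermittedThread.length P)) ∧
        RCLike.im (∫ x : Set.Icc (1 : ℝ) 2, threadFunctionalOnLine P.2 ((x : ℝ) : 𝕜)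
          ∂(φ (DualPermittedThread.length P))) = 0) ∧
      ∃ n : ℕ, globalDimension (BoundQuiverAlgebra I) = n ∧
        IsLUB (Set.range fun P : DualPermittedThread I =>
          RCLike.re (∫ x : Set.Icc (1 : ℝ) 2, threadFunctionalOnLine P.2 ((x : ℝ) : 𝕜)
            ∂(φ (DualPermittedThread.length P)))) (n : ℝ) := by
  obtain ⟨S, hS, rfl⟩ := hgentle.generated
  have hu : LeftUnique S := by
    intro a a' b c α α' β h h'
    by_contra hne
    rcases hgentle.xor_left α' α β hne with h₁ | h₁
    · exact h₁.2 ((PathAlgebra.twoPath_mem_span_iff hS).2 h)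
    · exact h₁.2 ((PathAlgebra.twoPath_mem_span_iff hS).2 h')
  obtain ⟨n, hn, hmax⟩ := exists_globalDimension_eq_isGreatest (𝕜 := 𝕜) hS hu hfin hgl
  have hint : ∀ P : DualPermittedThread
      (TwoSidedIdeal.span (PathAlgebra.of '' S : Set (PathAlgebra 𝕜 V))),
      ∫ x : Set.Icc (1 : ℝ) 2, threadFunctionalOnLine P.2 ((x : ℝ) : 𝕜) ∂(logMeasure P.1.length) =
        ((P.1.length : ℝ) : 𝕜) := fun P => by
    simp only [threadFunctionalOnLine_apply, integral_ofReal_logMeasure]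
  refine ⟨fun l => logMeasure l, fun l => ⟨⟨logStieltjes l,
    fun t ht => logStieltjes_eq_log_pow l ht.1, rfl⟩, logMeasure_Iic l⟩,
    fun P => ⟨?_, ?_⟩, n, hn, ?_⟩
  · simp only [threadFunctionalOnLine_apply]
    exact integrable_ofReal_logMeasure _
  · rw [DualPermittedThread.length, hint, RCLike.ofReal_im]
  · have hrange : (Set.range fun P : DualPermittedThread
        (TwoSidedIdeal.span (PathAlgebra.of '' S : Set (PathAlgebra 𝕜 V))) => RCLike.re
          (∫ x : Set.Icc (1 : ℝ) 2, threadFunctionalOnLine P.2 ((x : ℝ) : 𝕜)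
            ∂(logMeasure (DualPermittedThread.length P : ℕ)))) =
        (fun m : ℕ => (m : ℝ)) '' Set.range fun P : DualPermittedThread (monomialIdeal 𝕜 S) =>
          P.1.length := by
      rw [← Set.range_comp]
      congr 1
      funext P
      rw [DualPermittedThread.length, hint, RCLike.ofReal_re]
      rfl
    rw [hrange]
    exact (Nat.mono_cast.map_isGreatest hmax).isLUB
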